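/- Let $\mathbb{G}=(\mathbb{R}^n,\bullet)$ be a Carnot group in exponential coordinates of the first kind, with stratified Lie algebra $\mathfrak g=H_1\oplus\dots\oplus H_k$, $[H_1,H_l]=H_{l+1}$, $H_{k+1}=\{0\}$. Let $X_1,\dots,X_n$ be the left-invariant frame with $X_I(0)=\mathrm{e}_I$, adapted to the stratification and orthonormal for a fixed left-invariant metric; write $\mathrm{ord}(I)=l$ if $X_I\in H_l$. Put $H=H_1$, $V=H_2\oplus\dots\oplus H_k$, and call $I$ horizontal if $\mathrm{ord}(I)=1$ and vertical otherwise. Let $C^R_{IJ}=\langle[X_I,X_J],X_R\rangle$, $C^\alpha=[C^\alpha_{IJ}]_{I,J=1}^n$, and $C(Z)=\sum_{\alpha\ \mathrm{vertical}}z_\alpha C^\alpha$ for $Z=\sum_\alpha z_\alpha X_\alpha\in V$. Let $d_{cc}(y,z)$ be the infimum of the lengths of the piecewise smooth horizontal paths from $y$ to $z$. For a function $f$ put $\mathrm{grad}_H f=\sum_{i\ \mathrm{horizontal}}(X_if)X_i$ and $\mathrm{grad}_V f=\sum_{\alpha\ \mathrm{vertical}}(X_\alpha f)X_\alpha$. All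 vectors are written in the frame $X_1,\dots,X_n$, and $\mathcal P_V$ denotes the projection onto $V$. Let $r>0$ and let $x:[0,r]\to\mathbb{G}$ be a normal CC-geodesic of unit speed with $x(0)=x_0$. That is, for some curve of covectors $p$, the pair $(x,p)$ solves on $[0,r]$ Hamilton's equations $\dot x=\partial\mathcal H/\partial p$, $\dot p=-\partial\mathcal H/\partial x$ of $\mathcal H(x,p)=\frac12\sum_{i\ \mathrm{horizontal}}p(X_i(x))^2$; and, with $P_I(t)=p(t)(X_I(x(t)))$ and $P_H=\sum_{i\ \mathrm{horizontal}}P_iX_i$, one has $|P_H(t)|=1$ for all $t\in[0,r]$. Set $d(y)=d_{cc}(x_0,y)$. Then: (a) There is $\varepsilon\in(0,r]$ such that $d(x(t))=t$ for every $t\in[0,\varepsilon]$. (b) For every $t\in(0,r]$ with $d(x(t))=t$ (in particular for every $t\in(0,\varepsilon]$): (i) if $d$ is differentiable at $x(t)$, then $\mathrm{grad}_H d(x(t))=P_H(t)$; (ii) if $d$ is of class $C^2$ in a neighbourhood of $x(t)$, then $$\frac{d}{dt}\,\mathrm{grad}_V d(x(t))=-\mathcal P_V\big(C(\mathrm{grad}_V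 d(x(t)))\,P_H(t)\big),$$ that is, for every vertical index $\alpha$, $$\frac{d}{dt}X_\alpha d(x(t))=-\sum_{\beta:\ \mathrm{ord}(\beta)=\mathrm{ord}(\alpha)+1}X_\beta d(x(t))\,\langle C^\beta P_H(t),X_\alpha\rangle,$$ the derivatives being taken within $[0,r]$ (so one-sided at $t=r$). -/

import Mathlib

open Set
open scoped ContDiff

noncomputable section

/-- The space `ℝⁿ` of exponential coordinates (and of coefficient vectors in a left-invariant
orthonormal frame). -/
abbrev ExpCoord (n : ℕ) : Type := EuclideanSpace ℝ (Fin n)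

namespace CarnotGroup

/-- The left-invariant vector field `x ↦ (L_x)_* u = ∂(x • y)/∂y |_{y = 0} u` of a
multiplication `mul` on `ℝⁿ`. -/
def leftField {n : ℕ} (mul : ExpCoord n → ExpCoord n → ExpCoord n) (u : ExpCoord n) :
    ExpCoord n → ExpCoord n :=
  fun x => fderiv ℝ (fun y => mul x y) 0 u

/-- The Lie bracket on `𝔤 = T₀𝔾 = ℝⁿ`: the value at `0` of the commutator of the two
left-invariant vector fields. -/
def bracket {n : ℕ} (mul : ExpCoord n → ExpCoord n → ExpCoord n) (u v : ExpCoord n) :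
    ExpCoord n :=
  VectorField.lieBracket ℝ (leftField mul u) (leftField mul v) 0

/-- The `l`-th layer `H_l`, spanned by the standard basis vectors of order `l`. -/
def layer {n : ℕ} (ord : Fin n → ℕ) (l : ℕ) : Submodule ℝ (ExpCoord n) :=
  Submodule.span ℝ {u | ∃ I : Fin n, ord I = l ∧ u = EuclideanSpace.single I (1 : ℝ)}

end CarnotGroup

/-- A Carnot group of dimension `n` in exponential coordinates of the first kind with respect to
a basis of its Lie algebra which is adapted to the stratification and orthonormal for the fixed
left-invariant metric.  The group law is smooth, the identity is `0`, and the lines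
`t ↦ t x` are the one-parameter subgroups, that is, the exponential map is the identity.
The number `ord I` is the layer to which the `I`-th basis vector belongs.
(The step is the largest value of `ord`.) -/
structure CarnotGroup (n : ℕ) where
  mul : ExpCoord n → ExpCoord n → ExpCoord n
  contDiff_mul : ContDiff ℝ ∞ (fun z : ExpCoord n × ExpCoord n => mul z.1 z.2)
  mul_assoc : ∀ x y z, mul (mul x y) z = mul x (mul y z)
  zero_mul : ∀ x, mul 0 x = x
  mul_zero : ∀ x, mul x 0 = x
  smul_mul_smul : ∀ (s t : ℝ) (x : ExpCoord n), mul (s • x) (t • x) = (s + t) • x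
  ord : Fin n → ℕ
  one_le_ord : ∀ I, 1 ≤ ord I
  /-- `[H_1, H_l] = H_{l+1}` for all `l ≥ 1` (both sides vanish for large `l`). -/
  stratified : ∀ l : ℕ, 1 ≤ l →
    Submodule.span ℝ {w | ∃ u ∈ CarnotGroup.layer ord 1, ∃ v ∈ CarnotGroup.layer ord l,
      w = CarnotGroup.bracket mul u v} = CarnotGroup.layer ord (l + 1)

namespace CarnotGroup

variable {n : ℕ} (G : CarnotGroup n)

/-- In exponential coordinates the inverse of `x` is `-x`. -/
theorem mul_neg_self (x : ExpCoord n) : G.mul x (-x) = 0 := by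
  have h := G.smul_mul_smul 1 (-1) x
  simpa using h

theorem neg_mul_self (x : ExpCoord n) : G.mul (-x) x = 0 := by
  have h := G.smul_mul_smul (-1) 1 x
  simpa using h

/-- The left-invariant frame `X_1, …, X_n`. -/
def X (I : Fin n) : ExpCoord n → ExpCoord n :=
  leftField G.mul (EuclideanSpace.single I (1 : ℝ))

/-- The structural constants `C^R_{IJ} = ⟨[X_I, X_J], X_R⟩`. -/
def structConst (R I J : Fin n) : ℝ :=
  bracket G.mul (EuclideanSpace.single I (1 : ℝ)) (EuclideanSpace.single J (1 : ℝ)) R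

/-- The matrix `C^α = [C^α_{IJ}]_{I,J}`. -/
def structMatrix (α : Fin n) : Matrix (Fin n) (Fin n) ℝ :=
  Matrix.of fun I J => G.structConst α I J

/-- `I` is a horizontal index, i.e. `X_I` belongs to the first layer. -/
def IsHor (I : Fin n) : Prop := G.ord I = 1

instance : DecidablePred G.IsHor := fun I => inferInstanceAs (Decidable (G.ord I = 1))

/-- Projection onto `H`, in coefficients with respect to the frame `X_1, …, X_n`. -/
def projH (c : ExpCoord n) : ExpCoord n :=
  WithLp.toLp 2 fun I => if G.IsHor I then c I else 0

/-- Projection onto `V`, in coefficients with respect to the frame `X_1, …, X_n`. -/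
def projV (c : ExpCoord n) : ExpCoord n :=
  WithLp.toLp 2 fun I => if G.IsHor I then 0 else c I

/-- `C(Z) = ∑_{α vertical} z_α C^α`, for `Z = ∑ z_α X_α`. -/
def structOp (z : ExpCoord n) : Matrix (Fin n) (Fin n) ℝ :=
  ∑ α : Fin n with ¬ G.IsHor α, z α • G.structMatrix α

/-! ### The Carnot–Carathéodory distance -/

/-- Coefficients of the tangent vector `v` at `x` in the frame `X_1(x), …, X_n(x)`, computed as
`(L_{x⁻¹})_* v`.  The left-invariant metric is `⟨v, w⟩_x = ⟨coeff x v, coeff x w⟩`. -/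
def coeff (x v : ExpCoord n) : ExpCoord n :=
  fderiv ℝ (fun y => G.mul (-x) y) x v

/-- The tangent vector `v` at `x` is horizontal. -/
def IsHorVec (x v : ExpCoord n) : Prop :=
  ∀ I : Fin n, ¬ G.IsHor I → G.coeff x v I = 0

/-- `γ` is a piecewise smooth horizontal path on `[a, b]`. -/
def IsHorPath (γ : ℝ → ExpCoord n) (a b : ℝ) : Prop :=
  ∃ (m : ℕ) (τ : ℕ → ℝ), Monotone τ ∧ τ 0 = a ∧ τ m = b ∧
    ∀ i < m, ContDiffOn ℝ ∞ γ (Icc (τ i) (τ (i + 1))) ∧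
      ∀ t ∈ Ioo (τ i) (τ (i + 1)), G.IsHorVec (γ t) (deriv γ t)

/-- The length of a path on `[a, b]`. -/
def length (γ : ℝ → ExpCoord n) (a b : ℝ) : ℝ :=
  ∫ t in a..b, ‖G.coeff (γ t) (deriv γ t)‖

/-- The Carnot–Carathéodory distance: the infimum of the lengths of the piecewise smooth
horizontal paths from `x` to `y`. -/
def dcc (x y : ExpCoord n) : ℝ :=
  sInf {L : ℝ | ∃ (a b : ℝ) (γ : ℝ → ExpCoord n),
    G.IsHorPath γ a b ∧ γ a = x ∧ γ b = y ∧ L = G.length γ a b}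

/-! ### Normal curves -/

/-- The momentum function `P_Y(x, p) = p(Y(x)) = ∑_I p_I Y_I(x)` in canonical coordinates. -/
def momentum (Y : ExpCoord n → ExpCoord n) (x p : ExpCoord n) : ℝ :=
  ∑ I : Fin n, p I * Y x I

/-- The momenta `P = (P_1, …, P_n)`, `P_I = P_{X_I}`, i.e. `P = ∑ P_I X_I`. -/
def P (x p : ExpCoord n) : ExpCoord n :=
  WithLp.toLp 2 fun I => momentum (G.X I) x p

/-- `P_H = ∑_{i horizontal} P_i X_i`. -/
def PH (x p : ExpCoord n) : ExpCoord n := G.projH (G.P x p)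

/-- The sub-Riemannian Hamiltonian `½ ∑_{i horizontal} P_i²`. -/
def hamiltonian (x p : ExpCoord n) : ℝ :=
  (1 / 2) * ∑ i : Fin n with G.IsHor i, momentum (G.X i) x p ^ 2

/-- `(x, p)` solves Hamilton's equations `x' = ∂H/∂p`, `p' = -∂H/∂x` of the sub-Riemannian
Hamiltonian on `[a, b]`; thus `x` is a normal curve. -/
def IsNormalCurve (x p : ℝ → ExpCoord n) (a b : ℝ) : Prop :=
  ∀ t ∈ Icc a b,
    HasDerivWithinAt x (gradient (fun q => G.hamiltonian (x t) q) (p t)) (Icc a b) t ∧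
    HasDerivWithinAt p (-gradient (fun y => G.hamiltonian y (p t)) (x t)) (Icc a b) t

/-! ### Gradients -/

/-- The derivative `X_I f`. -/
def frameDeriv (I : Fin n) (f : ExpCoord n → ℝ) (x : ExpCoord n) : ℝ :=
  fderiv ℝ f x (G.X I x)

/-- The gradient `∑_I (X_I f) X_I`, in coefficients with respect to the orthonormal frame. -/
def grad (f : ExpCoord n → ℝ) (x : ExpCoord n) : ExpCoord n :=
  WithLp.toLp 2 fun I => G.frameDeriv I f x

/-- The horizontal gradient. -/
def gradH (f : ExpCoord n → ℝ) (x : ExpCoord n) : ExpCoord n := G.projH (G.grad f x)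

/-- The vertical gradient. -/
def gradV (f : ExpCoord n → ℝ) (x : ExpCoord n) : ExpCoord n := G.projV (G.grad f x)

end CarnotGroup

end

/-! Everything is read in the left-invariant frame. Hamilton's equations become `x' = leftMap x P_H`
together with the closed equation `P' = ad*_{P_H} P` for the momenta
(`IsNormalCurve.hasDerivWithinAt_P`).

Part (a) is a direct comparison with a competing horizontal path `y` of velocity `v`, supposed to
have length `L < T`. The normal curve is reparametrized by `σ` with `σ' = ρ`, where `ρ` slightly
exceeds `‖v‖` and has integral `T`. The difference `z = x(σ)⁻¹ • y` vanishes at both ends, hence so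
does `Φ = ⟪P(σ), z⟫`. In exponential coordinates `leftMap z - leftMap (-z)` is `[z, ·]` up to
`O(‖z‖²)`, so the terms of `Φ'` linear in `z` and proportional to `ρ` cancel against the momentum
equation (`abs_inner_sub_le`). What remains is `⟪P_H, w⟫` with `w = v - ρ P_H`, which is negative
and quadratic in `w` because `‖v‖ < ρ` (`inner_sub_smul_le`). The errors are also quadratic in the
integral `W` of `‖w‖`, and for small `T` the good term, of size `W² / T`, dominates. Thus `∫ Φ' <
0`, a contradiction.

Part (b)(i): `d` grows at most at unit rate along horizontal lines, so `‖grad_H d‖ ≤ 1`, while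
`d(x(s)) = s` for `s ≤ t` gives `⟪grad_H d, P_H⟫ = 1`. Two such vectors coincide.

Part (b)(ii): freeze `u = P_H(t)` and let `U` be the left-invariant field with value `u` at `0`.
Then `U d ≤ 1` near `x(t)` with equality at `x(t)`, so the differential of `U d` vanishes there. For
a left-invariant field `Y` this gives `d/dt (Y d) = U Y d = [U, Y] d`, and the stratification shows
which structure constants survive. -/

namespace CarnotGroup

variable {n : ℕ} (G : CarnotGroup n)

/-! ### Left translations -/

/-- The differential at `0` of the left translation by `x`. -/
noncomputable def leftMap (x : ExpCoord n) : ExpCoord n →L[ℝ] ExpCoord n :=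
  fderiv ℝ (fun y => G.mul x y) 0

theorem leftField_eq (u x : ExpCoord n) : leftField G.mul u x = G.leftMap x u := rfl

theorem contDiff_mul_left (x : ExpCoord n) : ContDiff ℝ ∞ (fun y => G.mul x y) :=
  G.contDiff_mul.comp (contDiff_const.prodMk contDiff_id)

theorem differentiable_mul_left (x : ExpCoord n) : Differentiable ℝ (fun y => G.mul x y) :=
  (G.contDiff_mul_left x).differentiable (by simp)

theorem contDiff_leftMap : ContDiff ℝ ∞ G.leftMap :=
  ContDiff.fderiv (f := fun x y => G.mul x y) (m := ∞) (n := ∞) (g := fun _ => 0)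
    G.contDiff_mul contDiff_const (by simp)

theorem differentiable_leftMap : Differentiable ℝ G.leftMap :=
  G.contDiff_leftMap.differentiable (by simp)

theorem neg_mul_mul_self (x y : ExpCoord n) : G.mul (-x) (G.mul x y) = y := by
  rw [← G.mul_assoc, G.neg_mul_self, G.zero_mul]

theorem mul_neg_mul_self (x y : ExpCoord n) : G.mul x (G.mul (-x) y) = y := by
  rw [← G.mul_assoc, G.mul_neg_self, G.zero_mul]

theorem neg_mul_rev (x y : ExpCoord n) : -G.mul x y = G.mul (-y) (-x) := by
  have h : G.mul (G.mul x y) (G.mul (-y) (-x)) = 0 := by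
    rw [G.mul_assoc, G.mul_neg_mul_self, G.mul_neg_self]
  have h2 := G.neg_mul_mul_self (G.mul x y) (G.mul (-y) (-x))
  rw [h, G.mul_zero] at h2
  exact h2

theorem leftMap_zero : G.leftMap 0 = ContinuousLinearMap.id ℝ _ := by
  have : (fun y => G.mul 0 y) = id := by
    funext y
    exact G.zero_mul y
  rw [leftMap, this, fderiv_id]

theorem hasFDerivAt_mul_left_zero (x : ExpCoord n) :
    HasFDerivAt (fun y => G.mul x y) (G.leftMap x) 0 :=
  (G.differentiable_mul_left x 0).hasFDerivAt

/-- `D(L_x)(z) (L_z)_* = (L_{x z})_*`. -/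
theorem fderiv_mul_leftMap (x z u : ExpCoord n) :
    fderiv ℝ (fun y => G.mul x y) z (G.leftMap z u) = G.leftMap (G.mul x z) u := by
  have h1 : HasFDerivAt (fun y => G.mul x y) (fderiv ℝ (fun y => G.mul x y) z) (G.mul z 0) := by
    rw [G.mul_zero]
    exact (G.differentiable_mul_left x z).hasFDerivAt
  have h2 := h1.comp (0 : ExpCoord n) (G.hasFDerivAt_mul_left_zero z)
  have h3 : ((fun y => G.mul x y) ∘ fun y => G.mul z y) = fun y => G.mul (G.mul x z) y := by
    funext y
    exact (G.mul_assoc x z y).symm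
  rw [h3] at h2
  rw [h2.unique (G.hasFDerivAt_mul_left_zero _) |>.symm]
  rfl

theorem coeff_leftMap (x u : ExpCoord n) : G.coeff x (G.leftMap x u) = u := by
  rw [coeff, fderiv_mul_leftMap, G.neg_mul_self, G.leftMap_zero]
  rfl

theorem leftMap_coeff (x v : ExpCoord n) : G.leftMap x (G.coeff x v) = v := by
  have h1 := (G.differentiable_mul_left (-x) x).hasFDerivAt
  have h2 : HasFDerivAt (fun y => G.mul x y) (G.leftMap x) (G.mul (-x) x) := by
    rw [G.neg_mul_self]
    exact G.hasFDerivAt_mul_left_zero x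
  have h3 := h2.comp x h1
  have h4 : ((fun y => G.mul x y) ∘ fun y => G.mul (-x) y) = id := by
    funext y
    exact G.mul_neg_mul_self x y
  rw [h4] at h3
  exact congrArg (fun L => L v) (h3.unique (hasFDerivAt_id x))

/-! ### Brackets -/

theorem hasFDerivAt_leftField (u x : ExpCoord n) :
    HasFDerivAt (leftField G.mul u) ((fderiv ℝ G.leftMap x).flip u) x :=
  ((G.differentiable_leftMap x).hasFDerivAt.clm_apply (hasFDerivAt_const u x)).congr_fderiv (by
    ext; simp)

theorem lieBracket_leftField_apply (u v x : ExpCoord n) :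
    VectorField.lieBracket ℝ (leftField G.mul u) (leftField G.mul v) x =
      fderiv ℝ G.leftMap x (G.leftMap x u) v - fderiv ℝ G.leftMap x (G.leftMap x v) u := by
  rw [VectorField.lieBracket, (G.hasFDerivAt_leftField v x).fderiv,
    (G.hasFDerivAt_leftField u x).fderiv]
  rfl

theorem bracket_eq (u v : ExpCoord n) :
    bracket G.mul u v = fderiv ℝ G.leftMap 0 u v - fderiv ℝ G.leftMap 0 v u := by
  rw [bracket, lieBracket_leftField_apply, G.leftMap_zero]
  rfl

theorem bracket_swap (u v : ExpCoord n) : bracket G.mul u v = -bracket G.mul v u := by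
  rw [bracket_eq, bracket_eq]
  abel

/-- The bracket as a bilinear map. -/
noncomputable def bracketL : ExpCoord n →L[ℝ] ExpCoord n →L[ℝ] ExpCoord n :=
  fderiv ℝ G.leftMap 0 - (fderiv ℝ G.leftMap 0).flip

theorem bracketL_apply (u v : ExpCoord n) : G.bracketL u v = bracket G.mul u v := by
  rw [bracket_eq]
  rfl

/-- Differentiating `D(L_x)(z) (L_z)_* v = (L_{x z})_* v` in `z` at `0`. The second differential of
`L_x` is symmetric, so it drops out on antisymmetrizing in `u` and `v`. -/
theorem fderiv_leftMap_apply (x u v : ExpCoord n) :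
    fderiv ℝ G.leftMap x (G.leftMap x u) v =
      fderiv ℝ (fderiv ℝ fun y => G.mul x y) 0 u v + G.leftMap x (fderiv ℝ G.leftMap 0 u v) := by
  have h1 : HasFDerivAt (fun z => G.leftMap (G.mul x z) v)
      ((((fderiv ℝ G.leftMap x).comp (G.leftMap x))).flip v) 0 := by
    have h : HasFDerivAt G.leftMap (fderiv ℝ G.leftMap x) (G.mul x 0) := by
      rw [G.mul_zero]
      exact (G.differentiable_leftMap x).hasFDerivAt
    exact ((h.comp (0 : ExpCoord n) (G.hasFDerivAt_mul_left_zero x)).clm_apply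
      (hasFDerivAt_const v _)).congr_fderiv (by ext; simp)
  have h2 : HasFDerivAt (fun z => fderiv ℝ (fun y => G.mul x y) z (G.leftMap z v)) _ 0 :=
    HasFDerivAt.clm_apply
      ((((G.contDiff_mul_left x).fderiv_right (m := 1) (WithTop.coe_le_coe.2 (le_top : (2 : ℕ∞) ≤ ⊤))).differentiable
        (by simp)).differentiableAt.hasFDerivAt)
      (G.hasFDerivAt_leftField v 0)
  have h3 : (fun z => fderiv ℝ (fun y => G.mul x y) z (G.leftMap z v)) =
      fun z => G.leftMap (G.mul x z) v := by
    funext z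
    exact G.fderiv_mul_leftMap x z v
  rw [h3] at h2
  have h4 := congrArg (fun L => L u) (h1.unique h2)
  simp only [ContinuousLinearMap.flip_apply, ContinuousLinearMap.comp_apply,
    _root_.add_apply, G.leftMap_zero] at h4
  rw [h4, add_comm]
  rfl

/-- The Lie bracket of two left-invariant fields is left-invariant. -/
theorem leftMap_bracket (x u v : ExpCoord n) :
    fderiv ℝ G.leftMap x (G.leftMap x u) v - fderiv ℝ G.leftMap x (G.leftMap x v) u =
      G.leftMap x (bracket G.mul u v) := by
  have hs : IsSymmSndFDerivAt ℝ (fun y => G.mul x y) 0 :=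
    (G.contDiff_mul_left x).contDiffAt.isSymmSndFDerivAt (by
      rw [minSmoothness_of_isRCLikeNormedField]
      exact WithTop.coe_le_coe.2 (le_top : (2 : ℕ∞) ≤ ⊤))
  rw [fderiv_leftMap_apply, fderiv_leftMap_apply, hs.eq u v, bracket_eq, map_sub]
  abel

/-- The line through `z` is a one-parameter subgroup, hence an integral curve of the left-invariant
field of `z`. This is where coordinates of the first kind enter. -/
theorem leftMap_smul_self (s : ℝ) (z : ExpCoord n) : G.leftMap (s • z) z = z := by
  have h1 : HasDerivAt (fun t : ℝ => G.mul (s • z) (t • z)) (G.leftMap (s • z) z) 0 := by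
    have h : HasFDerivAt (fun y => G.mul (s • z) y) (G.leftMap (s • z)) ((0 : ℝ) • z) := by
      rw [zero_smul]
      exact G.hasFDerivAt_mul_left_zero _
    have h' : HasDerivAt (fun t : ℝ => t • z) z 0 := by
      simpa using (hasDerivAt_id (0 : ℝ)).smul_const z
    exact h.comp_hasDerivAt (0 : ℝ) h'
  have h2 : HasDerivAt (fun t : ℝ => (s + t) • z) z 0 := by
    simpa using ((hasDerivAt_id (0 : ℝ)).const_add s).smul_const z
  simp only [G.smul_mul_smul] at h1
  exact h1.unique h2

theorem fderiv_leftMap_zero_self (z : ExpCoord n) : fderiv ℝ G.leftMap 0 z z = 0 := by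
  have h : HasFDerivAt (leftField G.mul z) ((fderiv ℝ G.leftMap 0).flip z) ((0 : ℝ) • z) := by
    rw [zero_smul]
    exact G.hasFDerivAt_leftField z 0
  have h' : HasDerivAt (fun t : ℝ => t • z) z 0 := by
    simpa using (hasDerivAt_id (0 : ℝ)).smul_const z
  have h1 := h.comp_hasDerivAt (0 : ℝ) h'
  have h2 : (leftField G.mul z ∘ fun t : ℝ => t • z) = fun _ => z := by
    funext t
    exact G.leftMap_smul_self t z
  rw [h2] at h1
  exact h1.unique (hasDerivAt_const (0 : ℝ) z)

theorem fderiv_leftMap_zero_swap (u v : ExpCoord n) :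
    fderiv ℝ G.leftMap 0 u v = -fderiv ℝ G.leftMap 0 v u := by
  have h := G.fderiv_leftMap_zero_self (u + v)
  simp only [map_add, _root_.add_apply, fderiv_leftMap_zero_self] at h
  rw [zero_add, add_zero, add_comm] at h
  exact eq_neg_of_add_eq_zero_left h

/-- The second-order term of the Baker–Campbell–Hausdorff formula: the differential of `leftMap` at
`0` vanishes on the diagonal, so it is antisymmetric and equals half the bracket. -/
theorem two_smul_fderiv_leftMap_zero (u v : ExpCoord n) :
    (2 : ℝ) • fderiv ℝ G.leftMap 0 u v = bracket G.mul u v := by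
  rw [bracket_eq, G.fderiv_leftMap_zero_swap v u, two_smul, sub_neg_eq_add]

end CarnotGroup

namespace CarnotGroup

variable {n : ℕ} (G : CarnotGroup n)

open scoped InnerProductSpace

/-! ### Normal curves -/

theorem inner_eq_sum (u v : ExpCoord n) : ⟪u, v⟫_ℝ = ∑ I, u I * v I := by
  simp [PiLp.inner_apply, mul_comm]

theorem sum_smul_single (c : ExpCoord n) :
    ∑ I, c I • EuclideanSpace.single I (1 : ℝ) = c := by
  ext J
  simp [Finset.sum_apply, Pi.single_apply]

theorem projH_eq_sum (c : ExpCoord n) :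
    G.projH c = ∑ I with G.IsHor I, c I • EuclideanSpace.single I (1 : ℝ) := by
  ext J
  simp only [projH, WithLp.ofLp_sum, WithLp.ofLp_smul, Finset.sum_apply, Pi.smul_apply,
    PiLp.single_apply, smul_eq_mul, mul_ite, mul_one, MulZeroClass.mul_zero]
  rw [Finset.sum_filter]
  simp only [← ite_and]
  rw [Finset.sum_eq_single J (fun I _ hI => if_neg fun h => hI h.2.symm) (by simp)]
  simp

/-- The projection onto `H` as a continuous linear map. -/
noncomputable def projHL : ExpCoord n →L[ℝ] ExpCoord n :=
  LinearMap.toContinuousLinearMap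
    { toFun := G.projH
      map_add' := fun u v => by
        ext I
        by_cases h : G.IsHor I <;> simp [projH, h]
      map_smul' := fun s u => by
        ext I
        by_cases h : G.IsHor I <;> simp [projH, h] }

theorem projHL_apply (c : ExpCoord n) : G.projHL c = G.projH c := rfl

theorem projH_apply_of_not_isHor (c : ExpCoord n) {I : Fin n} (h : ¬ G.IsHor I) :
    G.projH c I = 0 := by
  simp [projH, h]

theorem projH_apply_of_isHor (c : ExpCoord n) {I : Fin n} (h : G.IsHor I) :
    G.projH c I = c I := by
  simp [projH, h]

theorem projH_eq_self {c : ExpCoord n} (h : ∀ I, ¬ G.IsHor I → c I = 0) : G.projH c = c := by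
  ext I
  by_cases hI : G.IsHor I
  · exact G.projH_apply_of_isHor c hI
  · rw [G.projH_apply_of_not_isHor c hI, h I hI]

theorem inner_projH_left (c d : ExpCoord n) : ⟪G.projH c, d⟫_ℝ = ⟪c, G.projH d⟫_ℝ := by
  rw [inner_eq_sum, inner_eq_sum]
  refine Finset.sum_congr rfl fun I _ => ?_
  by_cases hI : G.IsHor I <;> simp [projH, hI]

theorem momentum_leftField (u x p : ExpCoord n) :
    momentum (leftField G.mul u) x p = ⟪p, G.leftMap x u⟫_ℝ := by
  rw [inner_eq_sum]
  rfl

theorem P_apply (x p : ExpCoord n) (I : Fin n) :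
    G.P x p I = ⟪p, G.leftMap x (EuclideanSpace.single I 1)⟫_ℝ :=
  G.momentum_leftField _ x p

theorem inner_P (x p c : ExpCoord n) : ⟪G.P x p, c⟫_ℝ = ⟪p, G.leftMap x c⟫_ℝ := by
  conv_rhs => rw [← sum_smul_single c]
  rw [inner_eq_sum, map_sum, inner_sum]
  refine Finset.sum_congr rfl fun I _ => ?_
  rw [map_smul, inner_smul_right, P_apply, mul_comm]

theorem PH_eq_sum (x p : ExpCoord n) :
    G.PH x p = ∑ i with G.IsHor i,
      ⟪p, G.leftMap x (EuclideanSpace.single i 1)⟫_ℝ • EuclideanSpace.single i (1 : ℝ) := by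
  rw [PH, projH_eq_sum]
  simp only [P_apply]

theorem hamiltonian_eq (x p : ExpCoord n) :
    G.hamiltonian x p = (1 / 2) * ∑ i with G.IsHor i,
      ⟪p, G.leftMap x (EuclideanSpace.single i 1)⟫_ℝ ^ 2 := by
  simp only [hamiltonian, X, momentum_leftField]

theorem gradient_hamiltonian_momentum (x p : ExpCoord n) :
    gradient (fun q => G.hamiltonian x q) p = G.leftMap x (G.PH x p) := by
  apply HasGradientAt.gradient
  rw [hasGradientAt_iff_hasFDerivAt]
  simp only [hamiltonian_eq]
  have h : ∀ i : Fin n, HasFDerivAt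
      (fun q : ExpCoord n => ⟪q, G.leftMap x (EuclideanSpace.single i 1)⟫_ℝ ^ 2) _ p := fun i =>
    ((hasFDerivAt_id p).inner ℝ
      (hasFDerivAt_const (G.leftMap x (EuclideanSpace.single i 1)) p)).pow 2
  refine ((HasFDerivAt.fun_sum fun i _ => h i).const_mul (1 / 2 : ℝ)).congr_fderiv ?_
  ext v
  rw [PH_eq_sum]
  simp [Finset.mul_sum, real_inner_comm]
  refine Finset.sum_congr rfl fun i _ => ?_
  ring

theorem inner_gradient_hamiltonian_position (x p v : ExpCoord n) :
    ⟪gradient (fun y => G.hamiltonian y p) x, v⟫_ℝ =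
      ⟪p, fderiv ℝ G.leftMap x v (G.PH x p)⟫_ℝ := by
  have h : ∀ i : Fin n, HasFDerivAt
      (fun y : ExpCoord n => ⟪p, leftField G.mul (EuclideanSpace.single i 1) y⟫_ℝ ^ 2) _ x :=
    fun i => ((hasFDerivAt_const p x).inner ℝ (G.hasFDerivAt_leftField _ x)).pow 2
  have h1 := (HasFDerivAt.fun_sum (u := Finset.univ.filter G.IsHor) fun i _ => h i).const_mul
    (1 / 2 : ℝ)
  have h2 : (fun y => G.hamiltonian y p) = fun y => (1 / 2 : ℝ) * ∑ i with G.IsHor i,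
      ⟪p, leftField G.mul (EuclideanSpace.single i 1) y⟫_ℝ ^ 2 := by
    funext y
    exact G.hamiltonian_eq y p
  rw [← h2] at h1
  rw [gradient, InnerProductSpace.toDual_symm_apply, h1.fderiv, PH_eq_sum]
  simp [Finset.mul_sum, inner_sum, inner_smul_right, leftField_eq]
  refine Finset.sum_congr rfl fun i _ => ?_
  ring

/-- The right-hand side of the momentum equation `P' = ad^*_{P_H} P`. -/
noncomputable def coadjoint (c : ExpCoord n) : ExpCoord n :=
  ∑ I, ⟪c, G.bracketL (G.projH c) (EuclideanSpace.single I 1)⟫_ℝ • EuclideanSpace.single I (1 : ℝ)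

theorem inner_coadjoint (c d : ExpCoord n) :
    ⟪G.coadjoint c, d⟫_ℝ = ⟪c, bracket G.mul (G.projH c) d⟫_ℝ := by
  conv_rhs => rw [← sum_smul_single d]
  rw [coadjoint, ← bracketL_apply, map_sum, inner_sum, sum_inner]
  refine Finset.sum_congr rfl fun I _ => ?_
  rw [map_smul, inner_smul_right, inner_smul_left, inner_eq_sum (EuclideanSpace.single I 1) d]
  simp [mul_comm]

theorem contDiff_coadjoint : ContDiff ℝ ∞ G.coadjoint := by
  refine ContDiff.sum fun I _ => ContDiff.fun_smul ?_ contDiff_const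
  exact contDiff_id.inner ℝ
    ((G.bracketL.contDiff.comp G.projHL.contDiff).clm_apply contDiff_const)

variable {G} {x p : ℝ → ExpCoord n} {a b : ℝ}

theorem IsNormalCurve.hasDerivWithinAt_position (h : G.IsNormalCurve x p a b) {t : ℝ}
    (ht : t ∈ Icc a b) :
    HasDerivWithinAt x (G.leftMap (x t) (G.PH (x t) (p t))) (Icc a b) t := by
  rw [← gradient_hamiltonian_momentum]
  exact (h t ht).1

/-- Position and momentum equations contribute the two halves of a commutator of left-invariant
fields; `leftMap_bracket` turns it into a bracket at `0`, which removes the dependence on the base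
point. -/
theorem IsNormalCurve.hasDerivWithinAt_inner (h : G.IsNormalCurve x p a b) {t : ℝ}
    (ht : t ∈ Icc a b) (c : ExpCoord n) :
    HasDerivWithinAt (fun s => ⟪p s, G.leftMap (x s) c⟫_ℝ)
      ⟪G.P (x t) (p t), bracket G.mul (G.PH (x t) (p t)) c⟫_ℝ (Icc a b) t := by
  have h1 := (G.hasFDerivAt_leftField c (x t)).comp_hasDerivWithinAt t
    (h.hasDerivWithinAt_position ht)
  refine ((h t ht).2.inner ℝ h1).congr_deriv ?_
  rw [inner_P, ← leftMap_bracket, inner_sub_right, inner_neg_left,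
    inner_gradient_hamiltonian_position, ← sub_eq_add_neg]
  rfl

theorem IsNormalCurve.hasDerivWithinAt_P (h : G.IsNormalCurve x p a b) {t : ℝ}
    (ht : t ∈ Icc a b) :
    HasDerivWithinAt (fun s => G.P (x s) (p s)) (G.coadjoint (G.P (x t) (p t))) (Icc a b) t := by
  have h1 := HasDerivWithinAt.fun_sum (u := Finset.univ) fun I _ =>
    (h.hasDerivWithinAt_inner ht (EuclideanSpace.single I 1)).smul_const
      (EuclideanSpace.single I (1 : ℝ))
  have h2 : (fun s => G.P (x s) (p s)) = fun s => ∑ I,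
      ⟪p s, G.leftMap (x s) (EuclideanSpace.single I 1)⟫_ℝ • EuclideanSpace.single I (1 : ℝ) := by
    funext s
    conv_lhs => rw [← sum_smul_single (G.P (x s) (p s))]
    simp only [P_apply]
  rw [h2]
  refine h1.congr_deriv ?_
  simp only [coadjoint, bracketL_apply]
  rfl

theorem IsNormalCurve.continuousOn_position (h : G.IsNormalCurve x p a b) :
    ContinuousOn x (Icc a b) := fun _ ht => (h.hasDerivWithinAt_position ht).continuousWithinAt

theorem IsNormalCurve.continuousOn_P (h : G.IsNormalCurve x p a b) :
    ContinuousOn (fun s => G.P (x s) (p s)) (Icc a b) :=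
  fun _ ht => (h.hasDerivWithinAt_P ht).continuousWithinAt

theorem IsNormalCurve.continuousOn_PH (h : G.IsNormalCurve x p a b) :
    ContinuousOn (fun s => G.PH (x s) (p s)) (Icc a b) :=
  G.projHL.continuous.comp_continuousOn h.continuousOn_P

/-- Bootstrapping: the pair `(x, P)` solves a differential equation with smooth right-hand side.
Smoothness makes arcs of `x` admissible in the definition of `dcc`. -/
theorem IsNormalCurve.contDiffOn (h : G.IsNormalCurve x p a b) (hab : a < b) :
    ContDiffOn ℝ ∞ x (Icc a b) := by
  have hu := uniqueDiffOn_Icc hab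
  have key : ∀ k : ℕ, ContDiffOn ℝ k x (Icc a b) ∧
      ContDiffOn ℝ k (fun s => G.P (x s) (p s)) (Icc a b) := by
    intro k
    induction k with
    | zero => simpa [contDiffOn_zero] using ⟨h.continuousOn_position, h.continuousOn_P⟩
    | succ k ih =>
      have hk : (k : ℕ∞ω) ≤ ∞ := WithTop.coe_le_coe.2 (le_top : (k : ℕ∞) ≤ ⊤)
      rw [Nat.cast_succ]
      refine ⟨(contDiffOn_succ_iff_derivWithin hu).2 ⟨fun t ht =>
        (h.hasDerivWithinAt_position ht).differentiableWithinAt, by simp, ?_⟩,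
        (contDiffOn_succ_iff_derivWithin hu).2 ⟨fun t ht =>
        (h.hasDerivWithinAt_P ht).differentiableWithinAt, by simp, ?_⟩⟩
      · refine ContDiffOn.congr ?_ fun t ht =>
          (h.hasDerivWithinAt_position ht).derivWithin (hu t ht)
        exact ((G.contDiff_leftMap.of_le hk).comp_contDiffOn ih.1).clm_apply
          (G.projHL.contDiff.comp_contDiffOn ih.2)
      · refine ContDiffOn.congr ?_ fun t ht => (h.hasDerivWithinAt_P ht).derivWithin (hu t ht)
        exact (G.contDiff_coadjoint.of_le hk).comp_contDiffOn ih.2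
  exact contDiffOn_infty.2 fun k => (key k).1

end CarnotGroup

/-! ### Integral estimates off a countable set, and Taylor bounds -/

open MeasureTheory in
theorem ae_Ioc_mem_Ioo_diff_countable {a b : ℝ} {S : Set ℝ} (hS : S.Countable) :
    ∀ᵐ t ∂(volume.restrict (Ioc a b)), t ∈ Ioo a b \ S := by
  have h1 : ∀ᵐ t ∂(volume.restrict (Ioc a b)), t ∈ Ioc a b := ae_restrict_mem measurableSet_Ioc
  have h2 : ∀ᵐ t ∂(volume.restrict (Ioc a b)), t ∉ insert b S :=
    ae_restrict_of_ae ((hS.insert b).ae_notMem volume)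
  filter_upwards [h1, h2] with t ht1 ht2
  rw [mem_insert_iff, not_or] at ht2
  exact ⟨⟨ht1.1, lt_of_le_of_ne ht1.2 ht2.1⟩, ht2.2⟩

open MeasureTheory in
theorem intervalIntegrable_deriv_of_norm_le {F : Type*} [NormedAddCommGroup F] [NormedSpace ℝ F]
    [CompleteSpace F] [SecondCountableTopology F] {f : ℝ → F} {g : ℝ → ℝ} {a b : ℝ} (hab : a ≤ b)
    {S : Set ℝ} (hS : S.Countable) (hg : IntervalIntegrable g volume a b)
    (hd : ∀ t ∈ Ioo a b \ S, ‖deriv f t‖ ≤ g t) :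
    IntervalIntegrable (deriv f) volume a b := by
  rw [intervalIntegrable_iff_integrableOn_Ioc_of_le hab] at hg ⊢
  refine Integrable.mono' hg (stronglyMeasurable_deriv f).aestronglyMeasurable ?_
  filter_upwards [ae_Ioc_mem_Ioo_diff_countable hS] with t ht using hd t ht

open MeasureTheory in
theorem norm_sub_le_integral_of_norm_deriv_le {F : Type*} [NormedAddCommGroup F]
    [NormedSpace ℝ F] [CompleteSpace F] [SecondCountableTopology F] {f : ℝ → F} {g : ℝ → ℝ}
    {a b : ℝ} (hab : a ≤ b) {S : Set ℝ} (hS : S.Countable) (hf : ContinuousOn f (Icc a b))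
    (hg : IntervalIntegrable g volume a b)
    (hd : ∀ t ∈ Ioo a b \ S, DifferentiableAt ℝ f t ∧ ‖deriv f t‖ ≤ g t) :
    ‖f b - f a‖ ≤ ∫ t in a..b, g t := by
  have hi := intervalIntegrable_deriv_of_norm_le hab hS hg fun t ht => (hd t ht).2
  rw [← integral_eq_of_hasDerivAt_off_countable_of_le f (deriv f) hab hS hf
    (fun t ht => (hd t ht).1.hasDerivAt) hi]
  refine intervalIntegral.norm_integral_le_of_norm_le hab ?_ hg
  rw [← ae_restrict_iff' measurableSet_Ioc]
  filter_upwards [ae_Ioc_mem_Ioo_diff_countable hS] with t ht using (hd t ht).2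

-- The bound `B` serves only to make the derivative integrable; `g` is what is integrated.
open MeasureTheory in
theorem sub_le_integral_of_deriv_le {f g B : ℝ → ℝ}
    {a b : ℝ} (hab : a ≤ b) {S : Set ℝ} (hS : S.Countable) (hf : ContinuousOn f (Icc a b))
    (hg : IntervalIntegrable g volume a b) (hB : IntervalIntegrable B volume a b)
    (hd : ∀ t ∈ Ioo a b \ S, DifferentiableAt ℝ f t ∧ deriv f t ≤ g t ∧ |deriv f t| ≤ B t) :
    f b - f a ≤ ∫ t in a..b, g t := by
  have hi := intervalIntegrable_deriv_of_norm_le (f := f) hab hS hB fun t ht => (hd t ht).2.2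
  rw [← integral_eq_of_hasDerivAt_off_countable_of_le f (deriv f) hab hS hf
    (fun t ht => (hd t ht).1.hasDerivAt) hi]
  refine intervalIntegral.integral_mono_ae_restrict hab hi hg ?_
  rw [restrict_Ioc_eq_restrict_Icc.symm]
  filter_upwards [ae_Ioc_mem_Ioo_diff_countable hS] with t ht using (hd t ht).2.1

/-- Mean value inequality on the unit ball, with bounds for `f` and its first two derivatives from
compactness. It is applied to `leftMap`. -/
theorem exists_taylor_bounds {E F : Type*} [NormedAddCommGroup E] [NormedSpace ℝ E]
    [ProperSpace E] [NormedAddCommGroup F] [NormedSpace ℝ F] {f : E → F} (hf : ContDiff ℝ ∞ f) :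
    ∃ C : ℝ, 1 ≤ C ∧ ∀ z : E, ‖z‖ ≤ 1 → ‖f z‖ ≤ C ∧ ‖f z - f 0‖ ≤ C * ‖z‖ ∧
      ‖f z - f (-z)‖ ≤ C * ‖z‖ ∧ ‖f z - f (-z) - (2 : ℝ) • fderiv ℝ f 0 z‖ ≤ C * ‖z‖ ^ 2 := by
  have hd0 : Differentiable ℝ f := hf.differentiable (by simp)
  have hc1 : ContDiff ℝ ∞ (fderiv ℝ f) := hf.fderiv_right (by simp)
  have hd1 : Differentiable ℝ (fderiv ℝ f) := hc1.differentiable (by simp)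
  have hc2 : ContDiff ℝ ∞ (fderiv ℝ (fderiv ℝ f)) := hc1.fderiv_right (by simp)
  have hK : IsCompact (Metric.closedBall (0 : E) 1) := isCompact_closedBall 0 1
  obtain ⟨C0, h0⟩ := hK.exists_bound_of_continuousOn hf.continuous.continuousOn
  obtain ⟨C1, h1⟩ := hK.exists_bound_of_continuousOn hc1.continuous.continuousOn
  obtain ⟨C2, h2⟩ := hK.exists_bound_of_continuousOn (f := fderiv ℝ (fderiv ℝ f)) hc2.continuous.continuousOn
  simp only [mem_closedBall_zero_iff] at h0 h1 h2
  have hC1 : 0 ≤ C1 := (norm_nonneg _).trans (h1 0 (by simp))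
  have hC2 : 0 ≤ C2 := (norm_nonneg _).trans (h2 0 (by simp))
  have hball (y : E) (hy : ‖y‖ ≤ 1) : y ∈ Metric.closedBall (0 : E) 1 :=
    mem_closedBall_zero_iff.2 hy
  have lip (y y' : E) (hy : ‖y‖ ≤ 1) (hy' : ‖y'‖ ≤ 1) :
      ‖f y - f y'‖ ≤ C1 * ‖y - y'‖ :=
    (convex_closedBall (0 : E) 1).norm_image_sub_le_of_norm_fderiv_le
      (fun w _ => hd0 w) (fun w hw => h1 w (mem_closedBall_zero_iff.1 hw))
      (hball y' hy') (hball y hy)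
  have lip1 (y : E) (hy : ‖y‖ ≤ 1) :
      ‖fderiv ℝ f y - fderiv ℝ f 0‖ ≤ C2 * ‖y‖ := by
    have := (convex_closedBall (0 : E) 1).norm_image_sub_le_of_norm_fderiv_le
      (fun w _ => hd1 w) (fun w hw => h2 w (mem_closedBall_zero_iff.1 hw))
      (hball 0 (by simp)) (hball y hy)
    rwa [sub_zero] at this
  refine ⟨max 1 (max C0 (max (2 * C1) (2 * C2))), le_max_left _ _, fun z hz => ?_⟩
  set C := max 1 (max C0 (max (2 * C1) (2 * C2)))
  have hC0 : C0 ≤ C := (le_max_left _ _).trans (le_max_right _ _)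
  have hC1' : 2 * C1 ≤ C := (le_max_left _ _).trans ((le_max_right _ _).trans (le_max_right _ _))
  have hC2' : 2 * C2 ≤ C := (le_max_right _ _).trans ((le_max_right _ _).trans (le_max_right _ _))
  have hz0 := norm_nonneg z
  have h2z : ‖z - -z‖ = 2 * ‖z‖ := by
    rw [sub_neg_eq_add, ← two_smul ℝ z, norm_smul]
    simp
  refine ⟨(h0 z hz).trans hC0, ?_, ?_, ?_⟩
  · have := lip z 0 hz (by simp)
    rw [sub_zero] at this
    exact this.trans (by nlinarith)
  · have := lip z (-z) hz (by simpa using hz)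
    rw [h2z] at this
    exact this.trans (by nlinarith)
  · have hg (w : E) : HasFDerivAt
        (fun y => f y - fderiv ℝ f 0 y)
        (fderiv ℝ f w - fderiv ℝ f 0) w :=
      (hd0 w).hasFDerivAt.sub (fderiv ℝ f 0).hasFDerivAt
    -- On the ball of radius `‖z‖` the map `f - Df(0)` has derivative at most `C2 * ‖z‖`, and `z`,
    -- `-z` are `2 * ‖z‖` apart.
    have := (convex_closedBall (0 : E) ‖z‖).norm_image_sub_le_of_norm_hasFDerivWithin_le
      (C := C2 * ‖z‖) (fun w _ => (hg w).hasFDerivWithinAt) (fun w hw => ?_)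
      (mem_closedBall_zero_iff.2 (norm_neg z).le) (mem_closedBall_zero_iff.2 le_rfl)
    · have he : f z - fderiv ℝ f 0 z -
          (f (-z) - fderiv ℝ f 0 (-z)) =
          f z - f (-z) - (2 : ℝ) • fderiv ℝ f 0 z := by
        rw [map_neg, two_smul]
        abel
      rw [he, h2z] at this
      exact this.trans (by nlinarith [sq_nonneg ‖z‖])
    · rw [mem_closedBall_zero_iff] at hw
      exact (lip1 w (hw.trans hz)).trans (by gcongr)

namespace CarnotGroup

open scoped InnerProductSpace

variable {n : ℕ} (G : CarnotGroup n)

/-! ### Local minimality of normal curves -/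

theorem exists_leftMap_bounds : ∃ C : ℝ, 1 ≤ C ∧ ∀ z : ExpCoord n, ‖z‖ ≤ 1 →
    ‖G.leftMap z‖ ≤ C ∧ ‖G.leftMap z - ContinuousLinearMap.id ℝ _‖ ≤ C * ‖z‖ ∧
    ‖G.leftMap z - G.leftMap (-z)‖ ≤ C * ‖z‖ ∧
    ‖G.leftMap z - G.leftMap (-z) - (2 : ℝ) • fderiv ℝ G.leftMap 0 z‖ ≤ C * ‖z‖ ^ 2 := by
  have h := exists_taylor_bounds G.contDiff_leftMap
  rwa [G.leftMap_zero] at h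

/-- Both factors move. The derivative in the first slot is a right translation, but `w • y = -((-y)
• (-w))` rewrites it through left translations alone. -/
theorem hasDerivAt_neg_mul {ξ y : ℝ → ExpCoord n} {c v : ExpCoord n} {s : ℝ}
    (hξ : HasDerivAt ξ (G.leftMap (ξ s) c) s) (hy : HasDerivAt y (G.leftMap (y s) v) s) :
    HasDerivAt (fun t => G.mul (-ξ t) (y t))
      (G.leftMap (G.mul (-ξ s) (y s)) v - G.leftMap (-G.mul (-ξ s) (y s)) c) s := by
  have hM : HasFDerivAt (fun z : ExpCoord n × ExpCoord n => G.mul z.1 z.2)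
      (fderiv ℝ (fun z : ExpCoord n × ExpCoord n => G.mul z.1 z.2) (-ξ s, y s)) (-ξ s, y s) :=
    (G.contDiff_mul.differentiable (by simp) _).hasFDerivAt
  set D := fderiv ℝ (fun z : ExpCoord n × ExpCoord n => G.mul z.1 z.2) (-ξ s, y s)
  have h2 : D (0, G.leftMap (y s) v) = G.leftMap (G.mul (-ξ s) (y s)) v := by
    rw [← G.fderiv_mul_leftMap]
    have := HasFDerivAt.comp (f := fun w => (-ξ s, w)) (y s) hM
      (hasFDerivAt_prodMk_right (-ξ s) (y s))
    have h := this.unique (G.differentiable_mul_left (-ξ s) (y s)).hasFDerivAt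
    rw [← h]
    rfl
  have h1 : D (-G.leftMap (ξ s) c, 0) = -G.leftMap (-G.mul (-ξ s) (y s)) c := by
    have ha := HasFDerivAt.comp (f := fun w => (w, y s)) (-ξ s) hM
      (hasFDerivAt_prodMk_left (-ξ s) (y s))
    have hb : HasFDerivAt (fun w => -G.mul (-y s) (-w))
        (-((fderiv ℝ (fun q => G.mul (-y s) q) (ξ s)).comp (-ContinuousLinearMap.id ℝ _)))
        (-ξ s) := by
      have : HasFDerivAt (fun q => G.mul (-y s) q) (fderiv ℝ (fun q => G.mul (-y s) q) (ξ s))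
          (- -ξ s) := by
        rw [neg_neg]
        exact (G.differentiable_mul_left _ _).hasFDerivAt
      exact (this.comp (-ξ s) (hasFDerivAt_id (-ξ s)).neg).neg
    have hc : (fun w => -G.mul (-y s) (-w)) =
        (fun z : ExpCoord n × ExpCoord n => G.mul z.1 z.2) ∘ fun w => (w, y s) := by
      funext w
      rw [G.neg_mul_rev, neg_neg, neg_neg]
      rfl
    rw [hc] at hb
    have hd := congrArg (fun L => L (-G.leftMap (ξ s) c)) (ha.unique hb)
    simp only [ContinuousLinearMap.comp_apply, _root_.neg_apply, map_neg, neg_neg,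
      ContinuousLinearMap.id_apply, ContinuousLinearMap.inl_apply, G.fderiv_mul_leftMap] at hd
    have he : ((-G.leftMap (ξ s) c, 0) : ExpCoord n × ExpCoord n) = -(G.leftMap (ξ s) c, 0) := by
      simp
    rw [G.neg_mul_rev, neg_neg, ← hd, he, map_neg]
  have h := hM.comp_hasDerivAt s (hξ.neg.prodMk hy)
  refine h.congr_deriv ?_
  have h3 : ((-G.leftMap (ξ s) c, G.leftMap (y s) v) : ExpCoord n × ExpCoord n) =
    (0, G.leftMap (y s) v) + (-G.leftMap (ξ s) c, 0) := by simp
  rw [h3, map_add, h1, h2, sub_eq_add_neg]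

end CarnotGroup

/-! ### Two estimates for the comparison argument -/

-- Expanding `‖v - ρ u‖²` gives `⟪u, w⟫ = -‖w‖² / (2ρ) - (ρ² - ‖v‖²) / (2ρ)` for `w = v - ρ u`, and
-- `ρ² - ‖v‖² ≥ δ ρ`. The free `k` linearizes the square by `‖w‖² / (2ρ) ≥ k ‖w‖ - k² ρ / 2`; a
-- constant `k = W / T` then yields `W² / (2T)` after integration without integrating `‖w‖² / ρ`.
open scoped InnerProductSpace in
theorem inner_sub_smul_le {E : Type*} [NormedAddCommGroup E] [InnerProductSpace ℝ E] {u v : E}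
    {ρ δ : ℝ} (hu : ‖u‖ = 1) (hρ : ρ = ‖v‖ + δ) (hδ : 0 < δ) (k : ℝ) :
    ⟪u, v - ρ • u⟫_ℝ ≤ -(k * ‖v - ρ • u‖) + k ^ 2 * ρ / 2 - δ / 2 := by
  have hv := norm_nonneg v
  have hρ0 : 0 < ρ := by linarith
  have h1 : ‖v - ρ • u‖ ^ 2 = ‖v‖ ^ 2 - 2 * (ρ * ⟪u, v⟫_ℝ) + ρ ^ 2 := by
    rw [norm_sub_sq_real, norm_smul, inner_smul_right, real_inner_comm, hu, mul_one,
      Real.norm_eq_abs, sq_abs]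
  have h2 : ⟪u, v - ρ • u⟫_ℝ = ⟪u, v⟫_ℝ - ρ := by
    rw [inner_sub_right, inner_smul_right, real_inner_self_eq_norm_sq, hu]
    ring
  have h3 : ρ * ⟪u, v - ρ • u⟫_ℝ ≤ ρ * (-(k * ‖v - ρ • u‖) + k ^ 2 * ρ / 2 - δ / 2) := by
    rw [h2]
    nlinarith [sq_nonneg (‖v - ρ • u‖ - k * ρ), mul_nonneg hδ.le hv]
  exact le_of_mul_le_mul_left h3 hρ0

-- First-exit argument: up to the first time at which the norm reaches `1` the derivative bound is
-- available, and its integral is too small to get there.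
open MeasureTheory in
theorem norm_le_one_of_norm_deriv_le {F : Type*} [NormedAddCommGroup F]
    [NormedSpace ℝ F] [CompleteSpace F] [SecondCountableTopology F] {z : ℝ → F} {g : ℝ → ℝ}
    {a b : ℝ} {S : Set ℝ} (hS : S.Countable) (hz : ContinuousOn z (Icc a b)) (hza : z a = 0)
    (hg : IntervalIntegrable g volume a b) (hg0 : ∀ t, 0 ≤ g t) (hg1 : ∫ t in a..b, g t < 1)
    (hd : ∀ t ∈ Ioo a b \ S, DifferentiableAt ℝ z t ∧ (‖z t‖ ≤ 1 → ‖deriv z t‖ ≤ g t)) :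
    ∀ t ∈ Icc a b, ‖z t‖ ≤ 1 := by
  by_contra! hcon
  obtain ⟨t₁, ht₁, h₁⟩ := hcon
  have hK : IsCompact (Icc a b ∩ (fun t => ‖z t‖) ⁻¹' Ici 1) :=
    isCompact_Icc.of_isClosed_subset (hz.norm.preimage_isClosed_of_isClosed isClosed_Icc
      isClosed_Ici) inter_subset_left
  obtain ⟨c, ⟨hc, hc1⟩, hmin⟩ := hK.exists_isLeast ⟨t₁, ht₁, h₁.le⟩
  have hsub : Icc a c ⊆ Icc a b := Icc_subset_Icc le_rfl hc.2
  have hlt (t : ℝ) (ht : t ∈ Ioo a c) : ‖z t‖ ≤ 1 := by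
    by_contra! h
    exact absurd (hmin ⟨hsub ⟨ht.1.le, ht.2.le⟩, h.le⟩) (not_le.2 ht.2)
  have hgc : IntervalIntegrable g volume a c := hg.mono_set (by
    rw [uIcc_of_le hc.1, uIcc_of_le (hc.1.trans hc.2)]
    exact hsub)
  have h := norm_sub_le_integral_of_norm_deriv_le hc.1 hS (hz.mono hsub) hgc fun t ht =>
    have ht' := hd t ⟨⟨ht.1.1, ht.1.2.trans_le hc.2⟩, ht.2⟩
    ⟨ht'.1, ht'.2 (hlt t ht.1)⟩
  have h2 : ∫ t in a..c, g t ≤ ∫ t in a..b, g t :=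
    intervalIntegral.integral_mono_interval le_rfl hc.1 hc.2
      (Filter.Eventually.of_forall fun t => hg0 t) hg
  rw [hza, sub_zero] at h
  have hc1' : 1 ≤ ‖z c‖ := hc1
  linarith

namespace CarnotGroup

open scoped InnerProductSpace

variable {n : ℕ} (G : CarnotGroup n)

/-- The derivative of the pairing of the momentum with the difference of a normal curve and another
horizontal path, up to terms that are quadratic in that difference. -/
theorem abs_inner_sub_le {C M : ℝ} {z u w c : ExpCoord n} {ρ : ℝ} (hC : 0 ≤ C) (hzM : ‖z‖ ≤ M)
    (hz1 : ‖G.leftMap z - ContinuousLinearMap.id ℝ _‖ ≤ C * ‖z‖)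
    (hz2 : ‖G.leftMap z - G.leftMap (-z) - (2 : ℝ) • fderiv ℝ G.leftMap 0 z‖ ≤ C * ‖z‖ ^ 2)
    (hc : G.projH c = u) (hw : G.projH w = w) (hu : ‖u‖ = 1) (hρ : 0 ≤ ρ) :
    |⟪c, G.leftMap z (w + ρ • u) - G.leftMap (-z) (ρ • u)⟫_ℝ + ⟪ρ • G.coadjoint c, z⟫_ℝ -
      ⟪u, w⟫_ℝ| ≤ ‖c‖ * C * M * ‖w‖ + ‖c‖ * C * M ^ 2 * ρ := by
  have hz0 := norm_nonneg z
  have hcw : ⟪c, w⟫_ℝ = ⟪u, w⟫_ℝ := by rw [← hc, inner_projH_left, hw]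
  -- The coadjoint term is `ρ ⟪c, [u, z]⟫`, and it supplies exactly the subtracted linear part `2
  -- D(leftMap)(0) z` applied to `ρ u`.
  have key : ⟪c, G.leftMap z (w + ρ • u) - G.leftMap (-z) (ρ • u)⟫_ℝ +
      ⟪ρ • G.coadjoint c, z⟫_ℝ - ⟪u, w⟫_ℝ =
      ⟪c, (G.leftMap z - ContinuousLinearMap.id ℝ (ExpCoord n)) w⟫_ℝ +
      ρ * ⟪c, (G.leftMap z - G.leftMap (-z) - (2 : ℝ) • fderiv ℝ G.leftMap 0 z) u⟫_ℝ := by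
    have hb : bracket G.mul u z = -((2 : ℝ) • fderiv ℝ G.leftMap 0 z u) := by
      rw [two_smul_fderiv_leftMap_zero, bracket_swap]
    rw [real_inner_smul_left, inner_coadjoint, hc, hb, ← hcw]
    simp only [map_add, map_smul, _root_.sub_apply, _root_.smul_apply,
      ContinuousLinearMap.id_apply, inner_sub_right, inner_add_right, inner_neg_right,
      inner_smul_right]
    ring
  rw [key]
  have e1 : |⟪c, (G.leftMap z - ContinuousLinearMap.id ℝ (ExpCoord n)) w⟫_ℝ| ≤ ‖c‖ * C * M * ‖w‖ := by
    calc _ ≤ ‖c‖ * ‖(G.leftMap z - ContinuousLinearMap.id ℝ (ExpCoord n)) w‖ := abs_real_inner_le_norm _ _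
      _ ≤ ‖c‖ * ((C * ‖z‖) * ‖w‖) := by
        gcongr
        exact ContinuousLinearMap.le_of_opNorm_le _ hz1 w
      _ ≤ ‖c‖ * ((C * M) * ‖w‖) := by gcongr
      _ = _ := by ring
  have e2 : |⟪c, (G.leftMap z - G.leftMap (-z) - (2 : ℝ) • fderiv ℝ G.leftMap 0 z) u⟫_ℝ| ≤
      ‖c‖ * C * M ^ 2 := by
    calc _ ≤ ‖c‖ * ‖(G.leftMap z - G.leftMap (-z) - (2 : ℝ) • fderiv ℝ G.leftMap 0 z) u‖ :=
          abs_real_inner_le_norm _ _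
      _ ≤ ‖c‖ * ((C * ‖z‖ ^ 2) * ‖u‖) := by
        gcongr
        exact ContinuousLinearMap.le_of_opNorm_le _ hz2 u
      _ ≤ ‖c‖ * ((C * M ^ 2) * ‖u‖) := by gcongr
      _ = _ := by rw [hu]; ring
  calc _ ≤ |⟪c, (G.leftMap z - ContinuousLinearMap.id ℝ (ExpCoord n)) w⟫_ℝ| +
        |ρ * ⟪c, (G.leftMap z - G.leftMap (-z) - (2 : ℝ) • fderiv ℝ G.leftMap 0 z) u⟫_ℝ| :=
        abs_add_le _ _
    _ ≤ ‖c‖ * C * M * ‖w‖ + ρ * (‖c‖ * C * M ^ 2) := by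
      rw [abs_mul, abs_of_nonneg hρ]
      gcongr
    _ = _ := by ring

end CarnotGroup

/-- The final numerical estimate in the proof of local minimality. -/
theorem le_of_minimality_estimate {R C M W T L k : ℝ} (hR0 : 0 ≤ R) (hC1 : 1 ≤ C) (hM0 : 0 ≤ M)
    (hW0 : 0 ≤ W) (hT0 : 0 < T) (hTε : 8 * (R + 1) * C ^ 2 * T ≤ 1) (hCT : 8 * C * T ≤ 1)
    (hMW : M ≤ 2 * C * W) (hkT : k * T = W)
    (hfinal : 0 ≤ (R * C * M - k) * W + (R * C * M ^ 2 + k ^ 2 / 2) * T - (T - L) / 2) :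
    T ≤ L := by
  have hk0 : 0 ≤ k := nonneg_of_mul_nonneg_left (hkT ▸ hW0) hT0
  have e2 : k ^ 2 / 2 * T = k * W / 2 := by
    rw [← hkT]
    ring
  have e3 : R * C * M * W ≤ 2 * R * C ^ 2 * W ^ 2 := by
    calc R * C * M * W ≤ R * C * (2 * C * W) * W := by gcongr
      _ = _ := by ring
  have e4 : R * C * M ^ 2 * T ≤ R * C ^ 2 * W ^ 2 := by
    calc R * C * M ^ 2 * T ≤ R * C * (2 * C * W) ^ 2 * T := by gcongr
      _ = R * C ^ 2 * W ^ 2 * (4 * C * T) := by ring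
      _ ≤ R * C ^ 2 * W ^ 2 * 1 := by
        gcongr
        linarith
      _ = _ := mul_one _
  have e5 : 3 * R * C ^ 2 * W ^ 2 ≤ k * W / 2 := by
    have h0 : 0 ≤ C ^ 2 * T := by positivity
    have h1 : 0 ≤ R * C ^ 2 * T := by positivity
    have : 3 * R * C ^ 2 * T ≤ 1 / 2 := by linarith
    calc 3 * R * C ^ 2 * W ^ 2 = 3 * R * C ^ 2 * T * (k * W) := by
          rw [← hkT]
          ring
      _ ≤ 1 / 2 * (k * W) := by gcongr
      _ = _ := by ring
  linarith

namespace CarnotGroup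

open scoped InnerProductSpace

variable {n : ℕ} {G : CarnotGroup n} {x p : ℝ → ExpCoord n} {r : ℝ}

set_option maxHeartbeats 800000 in
open MeasureTheory in
/-- A short piece of a normal curve is not longer than any other horizontal path with the same
endpoints. -/
theorem IsNormalCurve.exists_forall_le_integral (h : G.IsNormalCurve x p 0 r) (hr : 0 < r)
    (hunit : ∀ t ∈ Icc 0 r, ‖G.PH (x t) (p t)‖ = 1) :
    ∃ ε : ℝ, 0 < ε ∧ ε ≤ r ∧ ∀ T ∈ Ioc 0 ε, ∀ (a b : ℝ) (y v : ℝ → ExpCoord n) (S : Set ℝ),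
      a < b → S.Countable → ContinuousOn y (Icc a b) → IntervalIntegrable v volume a b →
      (∀ s ∈ Ioo a b \ S, HasDerivAt y (G.leftMap (y s) (v s)) s ∧ ContinuousAt v s ∧
        G.projH (v s) = v s) →
      y a = x 0 → y b = x T → T ≤ ∫ s in a..b, ‖v s‖ := by
  obtain ⟨C, hC1, hC⟩ := G.exists_leftMap_bounds
  obtain ⟨R, hR⟩ := isCompact_Icc.exists_bound_of_continuousOn h.continuousOn_P
  have hR0 : 0 ≤ R := (norm_nonneg _).trans (hR 0 (left_mem_Icc.2 hr.le))
  -- Small enough for `3 R C² T ≤ 1/2` in the final estimate; `R + 1` and `C ≥ 1` also give `8 C T ≤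
  -- 1`.
  refine ⟨min r (1 / (8 * (R + 1) * C ^ 2)), by positivity, min_le_left _ _, ?_⟩
  intro T hT a b y v S hab hS hy hv hd hya hyb
  have hTr : T ≤ r := hT.2.trans (min_le_left _ _)
  have hT0 := hT.1
  have hTε : 8 * (R + 1) * C ^ 2 * T ≤ 1 := by
    have := hT.2.trans (min_le_right _ _)
    rw [le_div_iff₀ (by positivity)] at this
    linarith
  have hCT : 8 * C * T ≤ 1 := by
    refine le_trans ?_ hTε
    have : 8 * C ≤ 8 * (R + 1) * C ^ 2 := by nlinarith [mul_nonneg hR0 (sq_nonneg C)]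
    gcongr
  by_contra! hL
  set L := ∫ s in a..b, ‖v s‖ with hLdef
  -- The missing length is spread evenly over `[a, b]`. Then `ρ` has integral `T` and stays positive
  -- where `v` vanishes, so `σ` is strictly increasing and sends interior times to interior times,
  -- where the normal curve has two-sided derivatives.
  set δ := (T - L) / (b - a) with hδdef
  have hba : 0 < b - a := sub_pos.2 hab
  have hδ : 0 < δ := div_pos (sub_pos.2 hL) hba
  have hδba : δ * (b - a) = T - L := div_mul_cancel₀ _ hba.ne'
  set ρ : ℝ → ℝ := fun s => ‖v s‖ + δ with hρdef
  have hρδ (s : ℝ) : δ ≤ ρ s := le_add_of_nonneg_left (norm_nonneg _)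
  have hρ0 (s : ℝ) : 0 < ρ s := hδ.trans_le (hρδ s)
  have hρi : IntervalIntegrable ρ volume a b := hv.norm.add intervalIntegrable_const
  have hρT : ∫ s in a..b, ρ s = T := by
    rw [intervalIntegral.integral_add hv.norm intervalIntegrable_const,
      intervalIntegral.integral_const, smul_eq_mul, mul_comm, hδba]
    ring
  have hsubI {c d : ℝ} (hc : a ≤ c) (hcd : c ≤ d) (hd : d ≤ b) {f : ℝ → ℝ}
      (hf : IntervalIntegrable f volume a b) : IntervalIntegrable f volume c d :=
    hf.mono_set (by
      rw [uIcc_of_le hcd, uIcc_of_le hab.le]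
      exact Icc_subset_Icc hc hd)
  -- the reparametrization of the normal curve
  set σ : ℝ → ℝ := fun s => ∫ t in a..s, ρ t with hσdef
  have hσa : σ a = 0 := intervalIntegral.integral_same
  have hσb : σ b = T := hρT
  have hσlt {c d : ℝ} (hc : a ≤ c) (hcd : c < d) (hd : d ≤ b) : σ c < σ d := by
    have h1 : σ d - σ c = ∫ t in c..d, ρ t :=
      intervalIntegral.integral_interval_sub_left (hsubI le_rfl (hc.trans hcd.le) hd hρi)
        (hsubI le_rfl hc (hcd.le.trans hd) hρi)
    have h2 : ∫ _ in c..d, δ ≤ ∫ t in c..d, ρ t :=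
      intervalIntegral.integral_mono_on hcd.le intervalIntegrable_const
        (hsubI hc hcd.le hd hρi) fun t _ => hρδ t
    rw [intervalIntegral.integral_const, smul_eq_mul] at h2
    nlinarith [mul_pos (sub_pos.2 hcd) hδ]
  have hσIcc (s : ℝ) (hs : s ∈ Icc a b) : σ s ∈ Icc 0 T := by
    constructor
    · rcases hs.1.eq_or_lt with rfl | h'
      · exact hσa.ge
      · exact hσa ▸ (hσlt le_rfl h' hs.2).le
    · rcases hs.2.eq_or_lt with rfl | h'
      · exact hσb.le
      · exact hσb ▸ (hσlt hs.1 h' le_rfl).le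
  have hσIoo (s : ℝ) (hs : s ∈ Ioo a b) : σ s ∈ Ioo 0 T :=
    ⟨hσa ▸ hσlt le_rfl hs.1 hs.2.le, hσb ▸ hσlt hs.1.le hs.2 le_rfl⟩
  have hσr : MapsTo σ (Icc a b) (Icc 0 r) := fun s hs =>
    ⟨(hσIcc s hs).1, (hσIcc s hs).2.trans hTr⟩
  have hσc : ContinuousOn σ (Icc a b) := by
    have := intervalIntegral.continuousOn_primitive_interval (μ := volume) (f := ρ) (a := a)
      (b := b) ((intervalIntegrable_iff' (by simp)).1 hρi)
    rwa [uIcc_of_le hab.le] at this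
  have hσd (s : ℝ) (hs : s ∈ Ioo a b \ S) : HasDerivAt σ (ρ s) s :=
    intervalIntegral.integral_hasDerivAt_right (hsubI le_rfl hs.1.1.le hs.1.2.le hρi)
      ⟨Ioc a b, Ioc_mem_nhds hs.1.1 hs.1.2, hρi.1.aestronglyMeasurable⟩
      ((hd s hs).2.1.norm.add continuousAt_const)
  -- the difference of the two paths
  set u : ℝ → ExpCoord n := fun s => G.PH (x (σ s)) (p (σ s)) with hudef
  set w : ℝ → ExpCoord n := fun s => v s - ρ s • u s with hwdef
  set z : ℝ → ExpCoord n := fun s => G.mul (-x (σ s)) (y s) with hzdef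
  set Φ : ℝ → ℝ := fun s => ⟪G.P (x (σ s)) (p (σ s)), z s⟫_ℝ with hΦdef
  have huc : ContinuousOn u (Icc a b) := h.continuousOn_PH.comp hσc hσr
  have hu1 (s : ℝ) (hs : s ∈ Icc a b) : ‖u s‖ = 1 := hunit _ (hσr hs)
  have hwi : IntervalIntegrable w volume a b :=
    hv.sub (hρi.smul_continuousOn (by rwa [uIcc_of_le hab.le]))
  have hzc : ContinuousOn z (Icc a b) :=
    G.contDiff_mul.continuous.comp_continuousOn
      ((h.continuousOn_position.comp hσc hσr).neg.prodMk hy)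
  have hΦc : ContinuousOn Φ (Icc a b) := (h.continuousOn_P.comp hσc hσr).inner hzc
  have hza : z a = 0 := by
    simp only [hzdef, hσa, hya, G.neg_mul_self]
  have hzb : z b = 0 := by
    simp only [hzdef, hσb, hyb, G.neg_mul_self]
  have hvw (s : ℝ) : v s = w s + ρ s • u s := by simp [hwdef]
  have hzd (s : ℝ) (hs : s ∈ Ioo a b \ S) : HasDerivAt z
      (G.leftMap (z s) (w s + ρ s • u s) - G.leftMap (-z s) (ρ s • u s)) s := by
    have hnhds : Icc 0 r ∈ nhds (σ s) :=
      Icc_mem_nhds (hσIoo s hs.1).1 ((hσIoo s hs.1).2.trans_le hTr)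
    have h1 := ((h.hasDerivWithinAt_position (hσr (Ioo_subset_Icc_self hs.1))).hasDerivAt
      hnhds).scomp s (hσd s hs)
    rw [← map_smul] at h1
    rw [← hvw]
    exact G.hasDerivAt_neg_mul h1 (hd s hs).1
  have hΦd (s : ℝ) (hs : s ∈ Ioo a b \ S) : HasDerivAt Φ
      (⟪G.P (x (σ s)) (p (σ s)), G.leftMap (z s) (w s + ρ s • u s) -
        G.leftMap (-z s) (ρ s • u s)⟫_ℝ +
        ⟪ρ s • G.coadjoint (G.P (x (σ s)) (p (σ s))), z s⟫_ℝ) s := by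
    have hnhds : Icc 0 r ∈ nhds (σ s) :=
      Icc_mem_nhds (hσIoo s hs.1).1 ((hσIoo s hs.1).2.trans_le hTr)
    have h1 := ((h.hasDerivWithinAt_P (hσr (Ioo_subset_Icc_self hs.1))).hasDerivAt
      hnhds).scomp s (hσd s hs)
    exact h1.inner ℝ (hzd s hs)
  have hzn (s : ℝ) (hs : s ∈ Ioo a b \ S) (M : ℝ) (hM : ‖z s‖ ≤ M) (hz1 : ‖z s‖ ≤ 1) :
      ‖deriv z s‖ ≤ C * ‖w s‖ + C * M * ρ s := by
    obtain ⟨k1, -, k3, -⟩ := hC (z s) hz1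
    rw [(hzd s hs).deriv]
    calc _ = ‖G.leftMap (z s) (w s) + (G.leftMap (z s) - G.leftMap (-z s)) (ρ s • u s)‖ := by
          congr 1
          rw [map_add, _root_.sub_apply]
          abel
      _ ≤ ‖G.leftMap (z s) (w s)‖ + ‖(G.leftMap (z s) - G.leftMap (-z s)) (ρ s • u s)‖ :=
        norm_add_le _ _
      _ ≤ C * ‖w s‖ + (C * ‖z s‖) * ‖ρ s • u s‖ := by
        gcongr
        · exact ContinuousLinearMap.le_of_opNorm_le _ k1 _
        · exact ContinuousLinearMap.le_of_opNorm_le _ k3 _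
      _ = C * ‖w s‖ + C * ‖z s‖ * ρ s := by
        rw [norm_smul, hu1 s (Ioo_subset_Icc_self hs.1), mul_one, Real.norm_of_nonneg (hρ0 s).le]
      _ ≤ C * ‖w s‖ + C * M * ρ s := by
        have := (hρ0 s).le
        gcongr
  have hwρ (s : ℝ) (hs : s ∈ Icc a b) : ‖w s‖ ≤ 2 * ρ s := by
    calc ‖w s‖ ≤ ‖v s‖ + ‖ρ s • u s‖ := norm_sub_le _ _
      _ = ‖v s‖ + ρ s := by
        rw [norm_smul, hu1 s hs, mul_one, Real.norm_of_nonneg (hρ0 s).le]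
      _ ≤ 2 * ρ s := by
        have : ρ s = ‖v s‖ + δ := rfl
        linarith
  -- While `‖z‖ ≤ 1`, the speed of `z` is at most `C ‖w‖ + C ρ ≤ 3 C ρ`, whose integral `3 C T` is
  -- below `1`. The Taylor bounds therefore apply throughout.
  have hz1 : ∀ s ∈ Icc a b, ‖z s‖ ≤ 1 := by
    refine norm_le_one_of_norm_deriv_le (g := fun s => 3 * C * ρ s) hS hzc hza
      (hρi.const_mul _) (fun t => by have := (hρ0 t).le; positivity) ?_ fun t ht =>
      ⟨(hzd t ht).differentiableAt, fun ht1 => (hzn t ht 1 ht1 ht1).trans ?_⟩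
    · rw [intervalIntegral.integral_const_mul, hρT]
      nlinarith
    · have := hwρ t (Ioo_subset_Icc_self ht.1)
      nlinarith
  -- the supremum of the difference is controlled by the integral of `w`
  set W := ∫ s in a..b, ‖w s‖ with hWdef
  have hW0 : 0 ≤ W := intervalIntegral.integral_nonneg hab.le fun _ _ => norm_nonneg _
  obtain ⟨c, hc, hmax⟩ := isCompact_Icc.exists_isMaxOn (nonempty_Icc.2 hab.le) hzc.norm
  set M := ‖z c‖ with hMdef
  have hzM : ∀ s ∈ Icc a b, ‖z s‖ ≤ M := fun s hs => hmax hs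
  have hM0 : 0 ≤ M := norm_nonneg _
  have hMW : M ≤ 2 * C * W := by
    have hg : IntervalIntegrable (fun s => C * ‖w s‖ + C * M * ρ s) volume a b :=
      (hwi.norm.const_mul C).add (hρi.const_mul (C * M))
    have h1 := norm_sub_le_integral_of_norm_deriv_le hc.1 hS
      (hzc.mono (Icc_subset_Icc le_rfl hc.2)) (hsubI le_rfl hc.1 hc.2 hg) fun t ht => by
        have ht' : t ∈ Ioo a b \ S := ⟨⟨ht.1.1, ht.1.2.trans_le hc.2⟩, ht.2⟩
        have ht2 := Ioo_subset_Icc_self ht'.1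
        exact ⟨(hzd t ht').differentiableAt, hzn t ht' M (hzM t ht2) (hz1 t ht2)⟩
    have h2 : ∫ s in a..c, (C * ‖w s‖ + C * M * ρ s) ≤ ∫ s in a..b, (C * ‖w s‖ + C * M * ρ s) :=
      intervalIntegral.integral_mono_interval le_rfl hc.1 hc.2
        (Filter.Eventually.of_forall fun t => by
          have := (hρ0 t).le
          simp only [Pi.zero_apply]
          positivity) hg
    rw [intervalIntegral.integral_add (hwi.norm.const_mul C) (hρi.const_mul (C * M)),
      intervalIntegral.integral_const_mul, intervalIntegral.integral_const_mul, hρT] at h2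
    rw [hza, sub_zero] at h1
    -- `M ≤ C W + C T M` and `C T ≤ 1/8`, so the last term is absorbed on the left.
    nlinarith
  -- the integrated inequality
  set k := W / T with hkdef
  have hkT : k * T = W := div_mul_cancel₀ _ hT0.ne'
  have hfinal : Φ b - Φ a ≤ ∫ s in a..b,
      ((R * C * M - k) * ‖w s‖ + (R * C * M ^ 2 + k ^ 2 / 2) * ρ s - δ / 2) := by
    refine sub_le_integral_of_deriv_le (B := fun s => (R * C * M + 1) * ‖w s‖ +
      (R * C * M ^ 2) * ρ s) hab.le hS hΦc
      (((hwi.norm.const_mul _).add (hρi.const_mul _)).sub intervalIntegrable_const)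
      ((hwi.norm.const_mul _).add (hρi.const_mul _)) fun t ht => ?_
    have ht' := Ioo_subset_Icc_self ht.1
    have hwH : G.projH (w t) = w t := by
      rw [← projHL_apply, hwdef]
      simp only [map_sub, map_smul, projHL_apply, (hd t ht).2.2]
      congr 2
      exact G.projH_eq_self fun I hI => G.projH_apply_of_not_isHor _ hI
    obtain ⟨-, k2, -, k4⟩ := hC (z t) (hz1 t ht')
    have h1 := G.abs_inner_sub_le (c := G.P (x (σ t)) (p (σ t))) (u := u t)
      (zero_le_one.trans hC1) (hzM t ht') k2 k4 rfl hwH (hu1 t ht') (hρ0 t).le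
    have h2 : ⟪u t, w t⟫_ℝ ≤ -(k * ‖w t‖) + k ^ 2 * ρ t / 2 - δ / 2 :=
      inner_sub_smul_le (hu1 t ht') rfl hδ k
    have h3 : |⟪u t, w t⟫_ℝ| ≤ ‖w t‖ := by
      have := abs_real_inner_le_norm (u t) (w t)
      rwa [hu1 t ht', one_mul] at this
    have h4 : ‖G.P (x (σ t)) (p (σ t))‖ * C * M * ‖w t‖ +
        ‖G.P (x (σ t)) (p (σ t))‖ * C * M ^ 2 * ρ t ≤
        R * C * M * ‖w t‖ + R * C * M ^ 2 * ρ t := by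
      have := hR _ (hσr ht')
      have := (hρ0 t).le
      gcongr
    have h5 := h1.trans h4
    refine ⟨(hΦd t ht).differentiableAt, ?_, ?_⟩
    · rw [(hΦd t ht).deriv]
      have := (abs_le.1 h5).2
      linarith
    · rw [(hΦd t ht).deriv]
      rw [abs_le] at h3 h5 ⊢
      constructor <;> linarith [h3.1, h3.2, h5.1, h5.2]
  have hΦa : Φ a = 0 := by simp [hΦdef, hza]
  have hΦb : Φ b = 0 := by simp [hΦdef, hzb]
  rw [intervalIntegral.integral_sub ((hwi.norm.const_mul _).add (hρi.const_mul _))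
    intervalIntegrable_const, intervalIntegral.integral_add (hwi.norm.const_mul _)
    (hρi.const_mul _), intervalIntegral.integral_const_mul, intervalIntegral.integral_const_mul,
    intervalIntegral.integral_const, hρT, hΦa, hΦb, smul_eq_mul] at hfinal
  have e1 : (b - a) * (δ / 2) = (T - L) / 2 := by linarith
  rw [e1, sub_zero] at hfinal
  exact hL.not_ge (le_of_minimality_estimate hR0 hC1 hM0 hW0 hT0 hTε hCT hMW hkT hfinal)

end CarnotGroup

/-! ### Subdivisions of an interval -/

/-- A point of `[τ 0, τ m]` outside the sequence `τ` lies in one of the gaps. -/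
theorem exists_mem_Ioo_of_notMem_range {τ : ℕ → ℝ} {s : ℝ} (hs : s ∉ range τ) :
    ∀ m : ℕ, s ∈ Icc (τ 0) (τ m) → ∃ i < m, s ∈ Ioo (τ i) (τ (i + 1)) := by
  intro m
  induction m with
  | zero => exact fun h => absurd ⟨0, le_antisymm h.1 h.2⟩ hs
  | succ m ih =>
    intro h
    rcases le_total s (τ m) with hm | hm
    · obtain ⟨i, hi, his⟩ := ih ⟨h.1, hm⟩
      exact ⟨i, hi.trans (Nat.lt_succ_self m), his⟩
    · exact ⟨m, Nat.lt_succ_self m, lt_of_le_of_ne hm fun e => hs ⟨m, e⟩,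
        lt_of_le_of_ne h.2 fun e => hs ⟨m + 1, e.symm⟩⟩

theorem continuousOn_Icc_of_pieces {F : Type*} [TopologicalSpace F] {f : ℝ → F} {τ : ℕ → ℝ}
    (hτ : Monotone τ) :
    ∀ m : ℕ, (∀ i < m, ContinuousOn f (Icc (τ i) (τ (i + 1)))) →
      ContinuousOn f (Icc (τ 0) (τ m)) := by
  intro m
  induction m with
  | zero => exact fun _ => by simp
  | succ m ih =>
    intro h
    rw [← Icc_union_Icc_eq_Icc (hτ (Nat.zero_le m)) (hτ (Nat.le_succ m))]
    exact (ih fun i hi => h i (hi.trans (Nat.lt_succ_self m))).union_of_isClosed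
      (h m (Nat.lt_succ_self m)) isClosed_Icc isClosed_Icc

namespace CarnotGroup

variable {n : ℕ} (G : CarnotGroup n)

/-! ### Horizontal paths -/

theorem contDiff_coeffMap :
    ContDiff ℝ ∞ fun x : ExpCoord n => fderiv ℝ (fun y => G.mul (-x) y) x :=
  ContDiff.fderiv (f := fun x y => G.mul (-x) y) (m := ∞) (n := ∞) (g := fun x => x)
    (G.contDiff_mul.comp (contDiff_fst.neg.prodMk contDiff_snd)) contDiff_id (by simp)

/-- The velocity of a path in left-invariant coordinates. -/
noncomputable def velocity (γ : ℝ → ExpCoord n) (s : ℝ) : ExpCoord n := G.coeff (γ s) (deriv γ s)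

theorem length_eq (γ : ℝ → ExpCoord n) (a b : ℝ) :
    G.length γ a b = ∫ t in a..b, ‖G.velocity γ t‖ := rfl

variable {G}

theorem continuousAt_velocity {γ : ℝ → ExpCoord n} {c d s : ℝ}
    (h : ContDiffOn ℝ ∞ γ (Icc c d)) (hs : s ∈ Ioo c d) : ContinuousAt (G.velocity γ) s := by
  have hO := h.mono Ioo_subset_Icc_self
  have hn : Ioo c d ∈ nhds s := Ioo_mem_nhds hs.1 hs.2
  have h1 := (hO.continuousOn_deriv_of_isOpen isOpen_Ioo (by simp)).continuousAt hn
  have h2 := hO.continuousOn.continuousAt hn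
  exact (G.contDiff_coeffMap.continuous.continuousAt.comp h2).clm_apply h1

-- The one-sided derivative is continuous up to the ends of the piece and agrees with `deriv` in the
-- interior, so the values of `deriv` at breakpoints do not matter.
open MeasureTheory in
theorem intervalIntegrable_velocity {γ : ℝ → ExpCoord n} {c d : ℝ} (hcd : c ≤ d)
    (h : ContDiffOn ℝ ∞ γ (Icc c d)) : IntervalIntegrable (G.velocity γ) volume c d := by
  rcases hcd.eq_or_lt with rfl | hlt
  · exact IntervalIntegrable.refl
  have h1 : ContinuousOn
      (fun s => fderiv ℝ (fun y => G.mul (-γ s) y) (γ s) (derivWithin γ (Icc c d) s))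
      (Icc c d) :=
    (G.contDiff_coeffMap.continuous.comp_continuousOn h.continuousOn).clm_apply
      (h.continuousOn_derivWithin (uniqueDiffOn_Icc hlt) (by simp))
  rw [← uIcc_of_le hcd] at h1
  refine h1.intervalIntegrable.congr_uIoo fun s hs => ?_
  rw [uIoo_of_le hcd] at hs
  simp only [velocity, coeff, derivWithin_of_mem_nhds (Icc_mem_nhds hs.1 hs.2), uIcc_of_le hcd]

theorem hasDerivAt_leftMap_velocity {γ : ℝ → ExpCoord n} {c d s : ℝ}
    (h : ContDiffOn ℝ ∞ γ (Icc c d)) (hs : s ∈ Ioo c d) :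
    HasDerivAt γ (G.leftMap (γ s) (G.velocity γ s)) s := by
  rw [velocity, leftMap_coeff]
  exact ((h.differentiableOn (by simp)).differentiableAt (Icc_mem_nhds hs.1 hs.2)).hasDerivAt

theorem IsHorPath.le {γ : ℝ → ExpCoord n} {a b : ℝ} (h : G.IsHorPath γ a b) : a ≤ b := by
  obtain ⟨m, τ, hτ, rfl, rfl, -⟩ := h
  exact hτ (Nat.zero_le m)

theorem IsHorPath.continuousOn {γ : ℝ → ExpCoord n} {a b : ℝ} (h : G.IsHorPath γ a b) :
    ContinuousOn γ (Icc a b) := by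
  obtain ⟨m, τ, hτ, rfl, rfl, hi⟩ := h
  exact continuousOn_Icc_of_pieces hτ m fun i him => (hi i him).1.continuousOn

open MeasureTheory in
theorem IsHorPath.intervalIntegrable {γ : ℝ → ExpCoord n} {a b : ℝ} (h : G.IsHorPath γ a b) :
    IntervalIntegrable (G.velocity γ) volume a b := by
  obtain ⟨m, τ, hτ, rfl, rfl, hi⟩ := h
  exact IntervalIntegrable.trans_iterate fun i him =>
    intervalIntegrable_velocity (hτ (Nat.le_succ i)) (hi i him).1

/-- Puts a piecewise smooth path in the form required of competitors in
`IsNormalCurve.exists_forall_le_integral`; the exceptional set consists of the breakpoints. -/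
theorem IsHorPath.exists_countable {γ : ℝ → ExpCoord n} {a b : ℝ} (h : G.IsHorPath γ a b) :
    ∃ S : Set ℝ, S.Countable ∧ ∀ s ∈ Ioo a b \ S,
      HasDerivAt γ (G.leftMap (γ s) (G.velocity γ s)) s ∧ ContinuousAt (G.velocity γ) s ∧
        G.projH (G.velocity γ s) = G.velocity γ s := by
  obtain ⟨m, τ, hτ, rfl, rfl, hi⟩ := h
  refine ⟨range τ, countable_range τ, fun s hs => ?_⟩
  obtain ⟨i, him, his⟩ := exists_mem_Ioo_of_notMem_range hs.2 m (Ioo_subset_Icc_self hs.1)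
  exact ⟨hasDerivAt_leftMap_velocity (hi i him).1 his, continuousAt_velocity (hi i him).1 his,
    G.projH_eq_self ((hi i him).2 s his)⟩

theorem isHorPath_refl (γ : ℝ → ExpCoord n) (a : ℝ) : G.IsHorPath γ a a :=
  ⟨0, fun _ => a, monotone_const, rfl, rfl, by simp⟩

theorem length_nonneg {γ : ℝ → ExpCoord n} {a b : ℝ} (hab : a ≤ b) : 0 ≤ G.length γ a b :=
  intervalIntegral.integral_nonneg hab fun _ _ => norm_nonneg _

/-- Follow `γ` up to time `b`, and then `η`. -/
noncomputable def concat (γ η : ℝ → ExpCoord n) (b : ℝ) : ℝ → ExpCoord n :=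
  fun t => if t ≤ b then γ t else η (t - b)

theorem concat_of_le {γ η : ℝ → ExpCoord n} {b t : ℝ} (h : t ≤ b) : concat γ η b t = γ t :=
  if_pos h

theorem concat_of_ge {γ η : ℝ → ExpCoord n} {b t : ℝ} (h0 : γ b = η 0) (h : b ≤ t) :
    concat γ η b t = η (t - b) := by
  rcases h.eq_or_lt with rfl | h
  · rw [concat_of_le le_rfl, h0, sub_self]
  · exact if_neg (not_le.2 h)

theorem deriv_concat_of_lt {γ η : ℝ → ExpCoord n} {b t : ℝ} (h : t < b) :
    deriv (concat γ η b) t = deriv γ t := by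
  refine Filter.EventuallyEq.deriv_eq ?_
  filter_upwards [Iio_mem_nhds h] with s hs using concat_of_le (le_of_lt hs)

theorem deriv_concat_of_gt {γ η : ℝ → ExpCoord n} {b t : ℝ} (h : b < t) :
    deriv (concat γ η b) t = deriv η (t - b) := by
  rw [← deriv_comp_sub_const]
  refine Filter.EventuallyEq.deriv_eq ?_
  filter_upwards [Ioi_mem_nhds h] with s hs using if_neg (not_le.2 hs)

theorem velocity_concat_of_lt {γ η : ℝ → ExpCoord n} {b t : ℝ} (h : t < b) :
    G.velocity (concat γ η b) t = G.velocity γ t := by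
  rw [velocity, velocity, deriv_concat_of_lt h, concat_of_le h.le]

theorem velocity_concat_of_gt {γ η : ℝ → ExpCoord n} {b t : ℝ} (h : b < t) :
    G.velocity (concat γ η b) t = G.velocity η (t - b) := by
  rw [velocity, velocity, deriv_concat_of_gt h, concat, if_neg (not_le.2 h)]

theorem IsHorPath.concat {γ η : ℝ → ExpCoord n} {a b s : ℝ} (h : G.IsHorPath γ a b) (hs : 0 ≤ s)
    (hη : ContDiffOn ℝ ∞ η (Icc 0 s)) (hηH : ∀ t ∈ Ioo 0 s, G.IsHorVec (η t) (deriv η t))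
    (h0 : γ b = η 0) : G.IsHorPath (concat γ η b) a (b + s) := by
  obtain ⟨m, τ, hτ, h1, h2, hi⟩ := h
  have hbs : b ≤ b + s := le_add_of_nonneg_right hs
  refine ⟨m + 1, fun i => if i ≤ m then τ i else b + s, ?_, ?_, ?_, ?_⟩
  · refine monotone_nat_of_le_succ fun i => ?_
    by_cases hi1 : i + 1 ≤ m
    · rw [if_pos hi1, if_pos (by lia)]
      exact hτ (Nat.le_succ i)
    · rw [if_neg hi1]
      split_ifs with hi2
      · exact (h2 ▸ hτ hi2 : τ i ≤ b).trans hbs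
      · exact le_rfl
  · simpa using h1
  · simp
  · intro i him
    by_cases hi1 : i + 1 ≤ m
    · have hib : τ (i + 1) ≤ b := h2 ▸ hτ hi1
      simp only [if_pos hi1, if_pos (show i ≤ m by lia)]
      obtain ⟨k1, k2⟩ := hi i hi1
      refine ⟨k1.congr fun t ht => concat_of_le (ht.2.trans hib), fun t ht => ?_⟩
      have ht' := ht.2.trans_le hib
      rw [deriv_concat_of_lt ht', concat_of_le ht'.le]
      exact k2 t ht
    · obtain rfl : i = m := by lia
      simp only [le_refl, if_true, if_neg hi1, h2]
      refine ⟨ContDiffOn.congr (f := fun t => η (t - b)) ?_ fun t ht => concat_of_ge h0 ht.1,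
        fun t ht => ?_⟩
      · exact hη.comp (contDiff_id.sub contDiff_const).contDiffOn fun t ht =>
          ⟨sub_nonneg.2 ht.1, by have := ht.2; change t - b ≤ s; linarith⟩
      · rw [deriv_concat_of_gt ht.1, concat_of_ge h0 ht.1.le]
        exact hηH _ ⟨sub_pos.2 ht.1, by have := ht.2; linarith⟩

theorem length_concat {γ η : ℝ → ExpCoord n} {a b s : ℝ} (h : G.IsHorPath γ a b) (hs : 0 ≤ s)
    (hη : ContDiffOn ℝ ∞ η (Icc 0 s)) (hηH : ∀ t ∈ Ioo 0 s, G.IsHorVec (η t) (deriv η t))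
    (h0 : γ b = η 0) :
    G.length (CarnotGroup.concat γ η b) a (b + s) = G.length γ a b + G.length η 0 s := by
  have hbs : b ≤ b + s := le_add_of_nonneg_right hs
  have hi := (h.concat hs hη hηH h0).intervalIntegrable.norm
  rw [length_eq, ← intervalIntegral.integral_add_adjacent_intervals
    (hi.mono_set (c := a) (d := b) ?_) (hi.mono_set (c := b) (d := b + s) ?_), length_eq,
    length_eq]
  · congr 1
    · refine intervalIntegral.integral_congr_Ioo_of_le h.le fun t ht => ?_
      simp only [velocity_concat_of_lt ht.2]
    · have he := intervalIntegral.integral_comp_sub_right (a := b) (b := b + s)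
        (fun t => ‖G.velocity η t‖) b
      rw [sub_self, add_sub_cancel_left] at he
      rw [← he]
      refine intervalIntegral.integral_congr_Ioo_of_le hbs fun t ht => ?_
      simp only [velocity_concat_of_gt ht.1]
  · rw [uIcc_of_le h.le, uIcc_of_le (h.le.trans hbs)]
    exact Icc_subset_Icc le_rfl hbs
  · rw [uIcc_of_le hbs, uIcc_of_le (h.le.trans hbs)]
    exact Icc_subset_Icc h.le le_rfl

/-! ### The Carnot–Carathéodory distance -/

variable (G) in
/-- There is a piecewise smooth horizontal path from `x` to `y`. -/
def Reachable (x y : ExpCoord n) : Prop :=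
  ∃ (a b : ℝ) (γ : ℝ → ExpCoord n), G.IsHorPath γ a b ∧ γ a = x ∧ γ b = y

theorem dcc_nonneg (x y : ExpCoord n) : 0 ≤ G.dcc x y := by
  refine Real.sInf_nonneg ?_
  rintro L ⟨a, b, γ, h, -, -, rfl⟩
  exact length_nonneg h.le

theorem IsHorPath.dcc_le {γ : ℝ → ExpCoord n} {a b : ℝ} (h : G.IsHorPath γ a b) :
    G.dcc (γ a) (γ b) ≤ G.length γ a b := by
  refine csInf_le ⟨0, ?_⟩ ⟨a, b, γ, h, rfl, rfl, rfl⟩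
  rintro L ⟨a', b', γ', h', -, -, rfl⟩
  exact length_nonneg h'.le

/-- With no path at all the infimum is that of the empty set, which is `0` by convention. Positivity
of the distance thus replaces Chow's connectivity theorem. -/
theorem reachable_of_dcc_pos {x y : ExpCoord n} (h : 0 < G.dcc x y) : G.Reachable x y := by
  by_contra hn
  have he : {L : ℝ | ∃ (a b : ℝ) (γ : ℝ → ExpCoord n),
      G.IsHorPath γ a b ∧ γ a = x ∧ γ b = y ∧ L = G.length γ a b} = ∅ := by
    rw [eq_empty_iff_forall_notMem]
    rintro L ⟨a, b, γ, h1, h2, h3, -⟩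
    exact hn ⟨a, b, γ, h1, h2, h3⟩
  rw [dcc, he, Real.sInf_empty] at h
  exact lt_irrefl _ h

theorem reachable_refl (x : ExpCoord n) : G.Reachable x x :=
  ⟨0, 0, fun _ => x, isHorPath_refl _ 0, rfl, rfl⟩

theorem dcc_self (x : ExpCoord n) : G.dcc x x = 0 := by
  have h := (isHorPath_refl (G := G) (fun _ => x) 0).dcc_le
  rw [length, intervalIntegral.integral_same] at h
  exact le_antisymm h (dcc_nonneg x x)

/-- Append `η` to every path ending at `y` and take the infimum. Reachability matters: otherwise
`dcc x y` would be the default value `0`. -/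
theorem Reachable.step {x y : ExpCoord n} (h : G.Reachable x y) {η : ℝ → ExpCoord n} {s : ℝ}
    (hs : 0 ≤ s) (hη : ContDiffOn ℝ ∞ η (Icc 0 s))
    (hηH : ∀ t ∈ Ioo 0 s, G.IsHorVec (η t) (deriv η t)) (h0 : η 0 = y) :
    G.Reachable x (η s) ∧ G.dcc x (η s) ≤ G.dcc x y + G.length η 0 s := by
  have key : ∀ (a b : ℝ) (γ : ℝ → ExpCoord n), G.IsHorPath γ a b → γ a = x → γ b = y →
      ∃ γ' : ℝ → ExpCoord n, G.IsHorPath γ' a (b + s) ∧ γ' a = x ∧ γ' (b + s) = η s ∧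
        G.length γ' a (b + s) = G.length γ a b + G.length η 0 s := by
    intro a b γ hγ ha hb
    have hb0 : γ b = η 0 := hb.trans h0.symm
    refine ⟨CarnotGroup.concat γ η b, hγ.concat hs hη hηH hb0, ?_, ?_,
      length_concat hγ hs hη hηH hb0⟩
    · rw [concat_of_le hγ.le, ha]
    · rw [concat_of_ge hb0 (le_add_of_nonneg_right hs), add_sub_cancel_left]
  obtain ⟨a, b, γ, hγ, ha, hb⟩ := h
  constructor
  · obtain ⟨γ', h1, h2, h3, -⟩ := key a b γ hγ ha hb
    exact ⟨a, b + s, γ', h1, h2, h3⟩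
  · rw [← sub_le_iff_le_add]
    refine le_csInf ⟨_, a, b, γ, hγ, ha, hb, rfl⟩ ?_
    rintro L ⟨a', b', γ', hγ', ha', hb', rfl⟩
    obtain ⟨γ'', h1, h2, h3, h4⟩ := key a' b' γ' hγ' ha' hb'
    rw [sub_le_iff_le_add, ← h4, ← h2, ← h3]
    exact h1.dcc_le

theorem hasDerivAt_mul_smul (y v : ExpCoord n) (t : ℝ) :
    HasDerivAt (fun s : ℝ => G.mul y (s • v)) (G.leftMap (G.mul y (t • v)) v) t := by
  have h1 : HasDerivAt (fun s : ℝ => s • v) v t := by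
    simpa using (hasDerivAt_id t).smul_const v
  have h2 := (G.differentiable_mul_left y (t • v)).hasFDerivAt.comp_hasDerivAt t h1
  rw [← G.fderiv_mul_leftMap, G.leftMap_smul_self]
  exact h2

theorem velocity_mul_smul (y v : ExpCoord n) (t : ℝ) :
    G.velocity (fun s : ℝ => G.mul y (s • v)) t = v := by
  rw [velocity, (hasDerivAt_mul_smul y v t).deriv, coeff_leftMap]

/-- The distance from `x` is 1-Lipschitz along horizontal lines. -/
theorem Reachable.dcc_mul_smul_le {x y v : ExpCoord n} (h : G.Reachable x y)
    (hv : G.projH v = v) {s : ℝ} (hs : 0 ≤ s) :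
    G.dcc x (G.mul y (s • v)) ≤ G.dcc x y + s * ‖v‖ := by
  have h1 := (h.step (η := fun t : ℝ => G.mul y (t • v)) hs
    ((G.contDiff_mul_left y).comp (contDiff_id.smul contDiff_const)).contDiffOn ?_ ?_).2
  · rw [length_eq] at h1
    simpa only [velocity_mul_smul, intervalIntegral.integral_const, sub_zero, smul_eq_mul] using h1
  · intro t _ I hI
    have h2 := velocity_mul_smul (G := G) y v t
    rw [velocity] at h2
    rw [h2, ← hv]
    exact G.projH_apply_of_not_isHor v hI
  · rw [zero_smul, G.mul_zero]

end CarnotGroup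

namespace CarnotGroup

open scoped InnerProductSpace

variable {n : ℕ} {G : CarnotGroup n} {x p : ℝ → ExpCoord n} {r : ℝ}

/-! ### The distance along a normal curve -/

/-- An arc of the normal curve is itself an admissible path, of length `t - s` by unit speed. -/
theorem IsNormalCurve.step (h : G.IsNormalCurve x p 0 r)
    (hunit : ∀ t ∈ Icc 0 r, ‖G.PH (x t) (p t)‖ = 1) {x₀ : ExpCoord n} {s t : ℝ} (hs : 0 ≤ s)
    (hst : s ≤ t) (htr : t ≤ r) (hr : 0 < r) (hx : G.Reachable x₀ (x s)) :
    G.Reachable x₀ (x t) ∧ G.dcc x₀ (x t) ≤ G.dcc x₀ (x s) + (t - s) := by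
  have hmem (a : ℝ) (ha : a ∈ Ioo 0 (t - s)) : s + a ∈ Ioo 0 r :=
    ⟨by linarith [ha.1], by linarith [ha.2]⟩
  have hvel (a : ℝ) (ha : a ∈ Ioo 0 (t - s)) :
      G.velocity (fun a => x (s + a)) a = G.PH (x (s + a)) (p (s + a)) := by
    have hm := hmem a ha
    rw [velocity, deriv_comp_const_add, ((h.hasDerivWithinAt_position
      (Ioo_subset_Icc_self hm)).hasDerivAt (Icc_mem_nhds hm.1 hm.2)).deriv, coeff_leftMap]
  have h1 := hx.step (η := fun a => x (s + a)) (sub_nonneg.2 hst) ?_ ?_ (by simp)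
  · rw [length_eq, intervalIntegral.integral_congr_Ioo_of_le (g := fun _ => (1 : ℝ))
      (sub_nonneg.2 hst) fun a ha => ?_] at h1
    · simpa using h1
    · simp only [hvel a ha]
      exact hunit _ (Ioo_subset_Icc_self (hmem a ha))
  · exact (h.contDiffOn hr).comp (contDiff_const.add contDiff_id).contDiffOn fun a ha =>
      ⟨add_nonneg hs ha.1, by have := ha.2; change s + a ≤ r; linarith⟩
  · intro a ha I hI
    have h2 := hvel a ha
    rw [velocity] at h2
    rw [h2]
    exact G.projH_apply_of_not_isHor _ hI

theorem IsNormalCurve.reachable (h : G.IsNormalCurve x p 0 r) (hr : 0 < r)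
    (hunit : ∀ t ∈ Icc 0 r, ‖G.PH (x t) (p t)‖ = 1) {t : ℝ} (ht : t ∈ Icc 0 r) :
    G.Reachable (x 0) (x t) :=
  (h.step hunit le_rfl ht.1 ht.2 hr (reachable_refl _)).1

theorem IsNormalCurve.dcc_le (h : G.IsNormalCurve x p 0 r) (hr : 0 < r)
    (hunit : ∀ t ∈ Icc 0 r, ‖G.PH (x t) (p t)‖ = 1) {t : ℝ} (ht : t ∈ Icc 0 r) :
    G.dcc (x 0) (x t) ≤ t := by
  have h1 := (h.step hunit le_rfl ht.1 ht.2 hr (reachable_refl _)).2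
  rwa [dcc_self, zero_add, sub_zero] at h1

/-- Short pieces of unit speed normal curves realize the Carnot–Carathéodory distance. -/
theorem IsNormalCurve.exists_dcc_eq (h : G.IsNormalCurve x p 0 r) (hr : 0 < r)
    (hunit : ∀ t ∈ Icc 0 r, ‖G.PH (x t) (p t)‖ = 1) :
    ∃ ε : ℝ, 0 < ε ∧ ε ≤ r ∧ ∀ t ∈ Icc 0 ε, G.dcc (x 0) (x t) = t := by
  obtain ⟨ε, hε0, hεr, hε⟩ := h.exists_forall_le_integral hr hunit
  refine ⟨ε, hε0, hεr, fun T hT => ?_⟩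
  have hTr : T ∈ Icc 0 r := ⟨hT.1, hT.2.trans hεr⟩
  refine le_antisymm (h.dcc_le hr hunit hTr) ?_
  rcases hT.1.eq_or_lt with rfl | hT0
  · exact dcc_nonneg _ _
  obtain ⟨a, b, γ, hγ, ha, hb⟩ := h.reachable hr hunit hTr
  refine le_csInf ⟨_, a, b, γ, hγ, ha, hb, rfl⟩ ?_
  clear hγ ha hb a b γ
  rintro L ⟨a, b, γ, hγ, ha, hb, rfl⟩
  -- A path over a single instant forces `x 0 = x T`; comparison with the constant path on `[0, 1]`,
  -- of length zero, then contradicts `0 < T`.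
  rcases hγ.le.eq_or_lt with rfl | hab
  · have h1 := hε T ⟨hT0, hT.2⟩ 0 1 (fun _ => x 0) (fun _ => 0) ∅ zero_lt_one countable_empty
      continuousOn_const intervalIntegrable_const (fun s _ => ⟨by
        simpa using hasDerivAt_const s (x 0), continuousAt_const, by
        rw [← projHL_apply, map_zero]⟩) rfl (ha.symm.trans hb)
    simp only [norm_zero, intervalIntegral.integral_zero] at h1
    exact absurd hT0 (not_lt.2 h1)
  · obtain ⟨S, hS, hd⟩ := hγ.exists_countable
    exact hε T ⟨hT0, hT.2⟩ a b γ (G.velocity γ) S hab hS hγ.continuousOn hγ.intervalIntegrable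
      hd ha hb

/-! ### The gradient of the distance -/

theorem inner_grad (f : ExpCoord n → ℝ) (y c : ExpCoord n) :
    ⟪G.grad f y, c⟫_ℝ = fderiv ℝ f y (G.leftMap y c) := by
  conv_rhs => rw [← sum_smul_single c]
  rw [inner_eq_sum, map_sum, map_sum]
  refine Finset.sum_congr rfl fun I _ => ?_
  rw [map_smul, map_smul, smul_eq_mul, mul_comm]
  rfl

theorem inner_gradH_left (f : ExpCoord n → ℝ) (y : ExpCoord n) {c : ExpCoord n}
    (hc : G.projH c = c) : ⟪G.gradH f y, c⟫_ℝ = ⟪G.grad f y, c⟫_ℝ := by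
  rw [gradH, inner_projH_left, hc]

theorem projH_projH (c : ExpCoord n) : G.projH (G.projH c) = G.projH c :=
  G.projH_eq_self fun _ hI => G.projH_apply_of_not_isHor _ hI

/-- Right difference quotient along `s ↦ y • (s v)`, a horizontal path of constant velocity `v`. -/
theorem Reachable.inner_grad_dcc_le {x₀ y v : ExpCoord n} (h : G.Reachable x₀ y)
    (hd : DifferentiableAt ℝ (G.dcc x₀) y) (hv : G.projH v = v) :
    ⟪G.grad (G.dcc x₀) y, v⟫_ℝ ≤ ‖v‖ := by
  rw [inner_grad]
  have h0 : G.mul y ((0 : ℝ) • v) = y := by rw [zero_smul, G.mul_zero]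
  have h1 : HasDerivAt (fun s : ℝ => G.dcc x₀ (G.mul y (s • v)))
      (fderiv ℝ (G.dcc x₀) y (G.leftMap y v)) 0 := by
    have h2 := hasDerivAt_mul_smul (G := G) y v 0
    have h3 : HasFDerivAt (G.dcc x₀) (fderiv ℝ (G.dcc x₀) y) (G.mul y ((0 : ℝ) • v)) := by
      rw [h0]
      exact hd.hasFDerivAt
    have h4 := h3.comp_hasDerivAt (0 : ℝ) h2
    rw [h0] at h4
    exact h4
  refine le_of_tendsto h1.tendsto_slope_zero_right ?_
  filter_upwards [self_mem_nhdsWithin] with s hs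
  have hs0 : 0 < s := hs
  rw [zero_add, h0, smul_eq_mul, inv_mul_le_iff₀ hs0]
  linarith [h.dcc_mul_smul_le hv hs0.le]

theorem IsNormalCurve.inner_grad_dcc (h : G.IsNormalCurve x p 0 r) (hr : 0 < r)
    (hunit : ∀ t ∈ Icc 0 r, ‖G.PH (x t) (p t)‖ = 1) {t : ℝ} (ht : t ∈ Ioc 0 r)
    (hdt : G.dcc (x 0) (x t) = t) (hd : DifferentiableAt ℝ (G.dcc (x 0)) (x t)) :
    ⟪G.grad (G.dcc (x 0)) (x t), G.PH (x t) (p t)⟫_ℝ = 1 := by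
  -- A shortcut to `x s` would give a shortcut to `x t`. Nothing is known beyond `t`, so the
  -- derivative is taken from the left.
  have hds (s : ℝ) (hs : s ∈ Icc 0 t) : G.dcc (x 0) (x s) = s := by
    have hsr : s ∈ Icc 0 r := ⟨hs.1, hs.2.trans ht.2⟩
    have h1 := h.dcc_le hr hunit hsr
    have h2 := (h.step hunit hs.1 hs.2 ht.2 hr (h.reachable hr hunit hsr)).2
    linarith
  have hsub : Icc 0 t ⊆ Icc 0 r := Icc_subset_Icc le_rfl ht.2
  have h1 := hd.hasFDerivAt.comp_hasDerivWithinAt t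
    ((h.hasDerivWithinAt_position (Ioc_subset_Icc_self ht)).mono hsub)
  have h2 : HasDerivWithinAt (G.dcc (x 0) ∘ x) 1 (Icc 0 t) t :=
    (hasDerivWithinAt_id t _).congr_of_mem (fun s hs => hds s hs) (right_mem_Icc.2 ht.1.le)
  rw [inner_grad]
  exact (uniqueDiffOn_Icc ht.1 t (right_mem_Icc.2 ht.1.le)).eq_deriv _ h1 h2

/-- Equality case of Cauchy–Schwarz. Testing the Lipschitz bound on `g = grad_H d` itself gives
`‖g‖² ≤ ‖g‖`, and with `⟪g, P_H⟫ = 1` this forces `‖g - P_H‖² ≤ 0`. -/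
theorem IsNormalCurve.gradH_dcc (h : G.IsNormalCurve x p 0 r) (hr : 0 < r)
    (hunit : ∀ t ∈ Icc 0 r, ‖G.PH (x t) (p t)‖ = 1) {t : ℝ} (ht : t ∈ Ioc 0 r)
    (hdt : G.dcc (x 0) (x t) = t) (hd : DifferentiableAt ℝ (G.dcc (x 0)) (x t)) :
    G.gradH (G.dcc (x 0)) (x t) = G.PH (x t) (p t) := by
  have htI := Ioc_subset_Icc_self ht
  have h1 := h.inner_grad_dcc hr hunit ht hdt hd
  have hP : G.projH (G.PH (x t) (p t)) = G.PH (x t) (p t) := projH_projH _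
  have hg : G.projH (G.gradH (G.dcc (x 0)) (x t)) = G.gradH (G.dcc (x 0)) (x t) := projH_projH _
  have h2 := (h.reachable hr hunit htI).inner_grad_dcc_le hd hg
  rw [← inner_gradH_left _ _ hP] at h1
  rw [← inner_gradH_left _ _ hg, real_inner_self_eq_norm_sq] at h2
  have h3 : ‖G.gradH (G.dcc (x 0)) (x t)‖ ≤ 1 := by
    by_contra! hc
    nlinarith
  have h4 : ‖G.gradH (G.dcc (x 0)) (x t) - G.PH (x t) (p t)‖ ^ 2 ≤ 0 := by
    rw [norm_sub_sq_real, h1, hunit t htI]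
    nlinarith [norm_nonneg (G.gradH (G.dcc (x 0)) (x t))]
  rw [← sub_eq_zero, ← norm_eq_zero]
  exact pow_eq_zero_iff two_ne_zero |>.1 (le_antisymm h4 (sq_nonneg _))

/-! ### Second derivatives -/

theorem hasFDerivAt_fderiv_leftField {f : ExpCoord n → ℝ} {q : ExpCoord n}
    (hf : ContDiffAt ℝ 2 f q) (c : ExpCoord n) :
    HasFDerivAt (fun y => fderiv ℝ f y (leftField G.mul c y))
      ((fderiv ℝ f q).comp ((fderiv ℝ G.leftMap q).flip c) +
        (fderiv ℝ (fderiv ℝ f) q).flip (leftField G.mul c q)) q :=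
  ((hf.fderiv_right (m := 1) (by norm_num)).differentiableAt (by simp)).hasFDerivAt.clm_apply
    (G.hasFDerivAt_leftField c q)

/-- `U Y f - Y U f = [U, Y] f` for left-invariant fields. -/
theorem fderiv_fderiv_leftField_sub {f : ExpCoord n → ℝ} {q : ExpCoord n}
    (hf : ContDiffAt ℝ 2 f q) (u c : ExpCoord n) :
    fderiv ℝ (fun y => fderiv ℝ f y (leftField G.mul c y)) q (G.leftMap q u) -
      fderiv ℝ (fun y => fderiv ℝ f y (leftField G.mul u y)) q (G.leftMap q c) =
      ⟪G.grad f q, bracket G.mul u c⟫_ℝ := by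
  have hs : IsSymmSndFDerivAt ℝ f q := hf.isSymmSndFDerivAt (by simp)
  rw [(hasFDerivAt_fderiv_leftField hf c).fderiv, (hasFDerivAt_fderiv_leftField hf u).fderiv,
    inner_grad, ← leftMap_bracket, map_sub]
  simp only [_root_.add_apply, ContinuousLinearMap.comp_apply, ContinuousLinearMap.flip_apply,
    leftField_eq]
  rw [hs.eq (G.leftMap q u) (G.leftMap q c)]
  ring

/-- With `P_H(t)` frozen to a left-invariant field `U`, the function `U d` is at most `1` near
`x(t)` and equals `1` there, so `Y U d = 0` at that point and `U Y d` reduces to `[U, Y] d`. Only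
the single point `x(t)` is used, so the derivative is valid on both sides even if `d(x(s)) = s`
fails for `s > t`. -/
theorem IsNormalCurve.hasDerivWithinAt_leftField_dcc (h : G.IsNormalCurve x p 0 r) (hr : 0 < r)
    (hunit : ∀ t ∈ Icc 0 r, ‖G.PH (x t) (p t)‖ = 1) {t : ℝ} (ht : t ∈ Ioc 0 r)
    (hdt : G.dcc (x 0) (x t) = t) (hd : ContDiffAt ℝ 2 (G.dcc (x 0)) (x t)) (c : ExpCoord n) :
    HasDerivWithinAt (fun s => fderiv ℝ (G.dcc (x 0)) (x s) (leftField G.mul c (x s)))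
      ⟪G.grad (G.dcc (x 0)) (x t), bracket G.mul (G.PH (x t) (p t)) c⟫_ℝ (Icc 0 r) t := by
  have htI := Ioc_subset_Icc_self ht
  have hdiff : DifferentiableAt ℝ (G.dcc (x 0)) (x t) := hd.differentiableAt (by simp)
  have hmax : IsLocalMax
      (fun y => fderiv ℝ (G.dcc (x 0)) y (leftField G.mul (G.PH (x t) (p t)) y)) (x t) := by
    -- Since `d(x(t)) = t > 0`, all nearby points are reachable, as the Lipschitz bound requires.
    have hpos : ∀ᶠ y in nhds (x t), 0 < G.dcc (x 0) y :=
      hdiff.continuousAt.eventually (lt_mem_nhds (hdt.symm ▸ ht.1))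
    filter_upwards [hpos, hd.eventually (by simp)] with y hy1 hy2
    have h1 := (reachable_of_dcc_pos hy1).inner_grad_dcc_le (hy2.differentiableAt (by simp))
      (projH_projH (G.P (x t) (p t)))
    have h2 := h.inner_grad_dcc hr hunit ht hdt hdiff
    rw [inner_grad] at h1 h2
    exact (h1.trans_eq (hunit t htI)).trans_eq h2.symm
  have h1 := fderiv_fderiv_leftField_sub (G := G) hd (G.PH (x t) (p t)) c
  rw [hmax.fderiv_eq_zero, _root_.zero_apply, sub_zero] at h1
  rw [← h1]
  exact (hasFDerivAt_fderiv_leftField hd c).differentiableAt.hasFDerivAt.comp_hasDerivWithinAt t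
    (h.hasDerivWithinAt_position htI)

/-! ### The stratification -/

theorem apply_eq_zero_of_mem_layer {ord : Fin n → ℕ} {l : ℕ} {c : ExpCoord n}
    (hc : c ∈ layer ord l) {I : Fin n} (hI : ord I ≠ l) : c I = 0 := by
  induction hc using Submodule.span_induction with
  | mem c hc =>
    obtain ⟨J, hJ, rfl⟩ := hc
    have : I ≠ J := fun e => hI (e ▸ hJ)
    simp [this]
  | zero => rfl
  | add c d _ _ hc hd => simp [hc, hd]
  | smul s c _ hc => simp [hc]

theorem projH_mem_layer (c : ExpCoord n) : G.projH c ∈ layer G.ord 1 := by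
  rw [projH_eq_sum]
  refine Submodule.sum_mem _ fun I hI => Submodule.smul_mem _ _ (Submodule.subset_span ⟨I, ?_, rfl⟩)
  exact (Finset.mem_filter.1 hI).2

theorem bracket_single_mem_layer (c : ExpCoord n) (α : Fin n) :
    bracket G.mul (G.projH c) (EuclideanSpace.single α 1) ∈ layer G.ord (G.ord α + 1) := by
  rw [← G.stratified (G.ord α) (G.one_le_ord α)]
  exact Submodule.subset_span
    ⟨_, projH_mem_layer c, _, Submodule.subset_span ⟨α, rfl, rfl⟩, rfl⟩

theorem structMatrix_mulVec (β α : Fin n) (c : ExpCoord n) :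
    (G.structMatrix β).mulVec c α = -bracket G.mul c (EuclideanSpace.single α 1) β := by
  have h1 : bracket G.mul c (EuclideanSpace.single α 1) =
      -∑ J, c J • bracket G.mul (EuclideanSpace.single α 1) (EuclideanSpace.single J 1) := by
    rw [bracket_swap]
    conv_lhs => rw [← sum_smul_single c]
    rw [← bracketL_apply, map_sum]
    simp only [map_smul, bracketL_apply]
  rw [h1]
  simp [Matrix.mulVec, dotProduct, structMatrix, structConst, mul_comm]

theorem structMatrix_mulVec_projH_eq_zero {β α : Fin n} (c : ExpCoord n)
    (h : G.ord β ≠ G.ord α + 1) : (G.structMatrix β).mulVec (G.projH c) α = 0 := by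
  rw [structMatrix_mulVec, apply_eq_zero_of_mem_layer (bracket_single_mem_layer c α) h, neg_zero]

theorem inner_bracket_projH_single (g c : ExpCoord n) (α : Fin n) :
    ⟪g, bracket G.mul (G.projH c) (EuclideanSpace.single α 1)⟫_ℝ =
      -∑ β with G.ord β = G.ord α + 1, g β * (G.structMatrix β).mulVec (G.projH c) α := by
  rw [Finset.sum_filter_of_ne fun β _ hβ => by
    by_contra hn
    rw [structMatrix_mulVec_projH_eq_zero c hn, MulZeroClass.mul_zero] at hβ
    exact hβ rfl, inner_eq_sum, ← Finset.sum_neg_distrib]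
  refine Finset.sum_congr rfl fun β _ => ?_
  rw [structMatrix_mulVec, mul_neg, neg_neg]

theorem projV_eq_sum (c : ExpCoord n) :
    G.projV c = ∑ I with ¬ G.IsHor I, c I • EuclideanSpace.single I (1 : ℝ) := by
  have h : G.projV c = c - G.projH c := by
    ext I
    by_cases hI : G.IsHor I <;> simp [projV, projH, hI]
  rw [h, projH_eq_sum, sub_eq_iff_eq_add', Finset.sum_filter_add_sum_filter_not, sum_smul_single]

/-- Brackets of `H_1` with `X_α` lie in the next layer, so the other vertical `β` contribute
nothing; conversely `ord β = ord α + 1 ≥ 2` makes `β` vertical. -/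
theorem structOp_gradV_mulVec (f : ExpCoord n → ℝ) (y c : ExpCoord n) (α : Fin n) :
    (G.structOp (G.gradV f y)).mulVec (G.projH c) α =
      ∑ β with G.ord β = G.ord α + 1,
        G.frameDeriv β f y * (G.structMatrix β).mulVec (G.projH c) α := by
  have h1 : (G.structOp (G.gradV f y)).mulVec (G.projH c) α =
      ∑ β with ¬ G.IsHor β, G.frameDeriv β f y * (G.structMatrix β).mulVec (G.projH c) α := by
    rw [structOp, Matrix.sum_mulVec, Finset.sum_apply]
    refine Finset.sum_congr rfl fun β hβ => ?_
    rw [Matrix.smul_mulVec, Pi.smul_apply, smul_eq_mul, gradV, projV]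
    simp only [if_neg (Finset.mem_filter.1 hβ).2]
    rfl
  rw [h1]
  symm
  refine Finset.sum_subset (fun β hβ => ?_) fun β _ hβ => ?_
  · have h2 := (Finset.mem_filter.1 hβ).2
    refine Finset.mem_filter.2 ⟨Finset.mem_univ _, fun h3 : G.ord β = 1 => ?_⟩
    have := G.one_le_ord α
    lia
  · rw [structMatrix_mulVec_projH_eq_zero c fun h2 =>
      hβ (Finset.mem_filter.2 ⟨Finset.mem_univ _, h2⟩), MulZeroClass.mul_zero]

theorem IsNormalCurve.hasDerivWithinAt_frameDeriv_dcc (h : G.IsNormalCurve x p 0 r) (hr : 0 < r)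
    (hunit : ∀ t ∈ Icc 0 r, ‖G.PH (x t) (p t)‖ = 1) {t : ℝ} (ht : t ∈ Ioc 0 r)
    (hdt : G.dcc (x 0) (x t) = t) (hd : ContDiffAt ℝ 2 (G.dcc (x 0)) (x t)) (α : Fin n) :
    HasDerivWithinAt (fun s => G.frameDeriv α (G.dcc (x 0)) (x s))
      (-∑ β : Fin n with G.ord β = G.ord α + 1, G.frameDeriv β (G.dcc (x 0)) (x t) *
        ((G.structMatrix β).mulVec (G.PH (x t) (p t))) α) (Icc 0 r) t :=
  (h.hasDerivWithinAt_leftField_dcc hr hunit ht hdt hd (EuclideanSpace.single α 1)).congr_deriv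
    (inner_bracket_projH_single _ _ α)

theorem IsNormalCurve.hasDerivWithinAt_gradV_dcc (h : G.IsNormalCurve x p 0 r) (hr : 0 < r)
    (hunit : ∀ t ∈ Icc 0 r, ‖G.PH (x t) (p t)‖ = 1) {t : ℝ} (ht : t ∈ Ioc 0 r)
    (hdt : G.dcc (x 0) (x t) = t) (hd : ContDiffAt ℝ 2 (G.dcc (x 0)) (x t)) :
    HasDerivWithinAt (fun s => G.gradV (G.dcc (x 0)) (x s))
      (-G.projV (WithLp.toLp 2
        ((G.structOp (G.gradV (G.dcc (x 0)) (x t))).mulVec (G.PH (x t) (p t)))))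
      (Icc 0 r) t := by
  have h1 := HasDerivWithinAt.fun_sum (u := Finset.univ.filter fun I => ¬ G.IsHor I) fun α _ =>
    (h.hasDerivWithinAt_frameDeriv_dcc hr hunit ht hdt hd α).smul_const
      (EuclideanSpace.single α (1 : ℝ))
  have h2 : (fun s => G.gradV (G.dcc (x 0)) (x s)) = fun s => ∑ α with ¬ G.IsHor α,
      G.frameDeriv α (G.dcc (x 0)) (x s) • EuclideanSpace.single α (1 : ℝ) := by
    funext s
    rw [gradV, projV_eq_sum]
    rfl
  rw [h2]
  refine h1.congr_deriv ?_
  rw [projV_eq_sum, ← Finset.sum_neg_distrib]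
  refine Finset.sum_congr rfl fun α _ => ?_
  rw [neg_smul, PH, ← structOp_gradV_mulVec]

end CarnotGroup

theorem mainTheorem8 {n : ℕ} (G : CarnotGroup n) (x₀ : ExpCoord n) (r : ℝ) (hr : 0 < r)
    (x p : ℝ → ExpCoord n) (hnormal : G.IsNormalCurve x p 0 r) (hx₀ : x 0 = x₀)
    (hunit : ∀ t ∈ Set.Icc 0 r, ‖G.PH (x t) (p t)‖ = 1) :
    (∃ ε : ℝ, 0 < ε ∧ ε ≤ r ∧ ∀ t ∈ Set.Icc 0 ε, G.dcc x₀ (x t) = t) ∧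
    ∀ t ∈ Set.Ioc 0 r, G.dcc x₀ (x t) = t →
      (DifferentiableAt ℝ (G.dcc x₀) (x t) →
        G.gradH (G.dcc x₀) (x t) = G.PH (x t) (p t)) ∧
      (ContDiffAt ℝ 2 (G.dcc x₀) (x t) →
        HasDerivWithinAt (fun s => G.gradV (G.dcc x₀) (x s))
          (-G.projV (WithLp.toLp 2
            ((G.structOp (G.gradV (G.dcc x₀) (x t))).mulVec (G.PH (x t) (p t)))))
          (Set.Icc 0 r) t ∧
        ∀ α : Fin n, ¬ G.IsHor α →
          HasDerivWithinAt (fun s => G.frameDeriv α (G.dcc x₀) (x s))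
            (-∑ β : Fin n with G.ord β = G.ord α + 1,
              G.frameDeriv β (G.dcc x₀) (x t) *
                ((G.structMatrix β).mulVec (G.PH (x t) (p t))) α)
            (Set.Icc 0 r) t) := by
  subst hx₀
  refine ⟨hnormal.exists_dcc_eq hr hunit, fun t ht hdt => ⟨hnormal.gradH_dcc hr hunit ht hdt,
    fun hd => ⟨hnormal.hasDerivWithinAt_gradV_dcc hr hunit ht hdt hd, fun α _ =>
      hnormal.hasDerivWithinAt_frameDeriv_dcc hr hunit ht hdt hd α⟩⟩⟩
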